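/- Let $d\ge 1$ and let $p(n;x)$, $n\in\mathbb N=\{1,2,\dots\}$, $x\in\mathbb Z^d$, be the $n$-step transition function of the simple random walk on $\mathbb Z^d$ started at $0$: $p(1;\pm e_j)=\frac1{2d}$ for $j=1,\dots,d$, $p(1;x)=0$ for all other $x$, and $p(n+1;x)=\sum_{y\in\mathbb Z^d}p(n;y)\,p(1;x-y)$. Put $\kappa(u)=\frac1d(\cosh u_1+\dots+\cosh u_d)$ for $u\in\mathbb R^d$, let $B_u$ be the quadratic form $B_u(w,w)=D_w^2\log\kappa(u)$ on $\mathbb R^d$ (where $D_w$ is the derivative along $w$; $\det B_u$ is taken in the standard basis), and for $\delta\in\mathcal M=\{\delta\in\mathbb R^d:\|\delta\|_1<1\}$ let $$\phi(\delta)=\max\{\langle u,\delta\rangle-\log\kappa(u):u\in\mathbb R^d\}.$$ For every $\delta\in\mathcal M$ the maximum is attained, $\phi$ is differentiable at $\delta$, and $\det B_s>0$ for $s=\nabla\phi(\delta)$. Moreover, there is a constant $C>0$ depending only on $d$ such that for all $n\in\mathbb N$ and $x\in\mathbb Z^d$, with $\delta=x/n$: - if $\|x\|_1\equiv n\pmod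 2$ and $\|\delta\|_1<1$, then, with $s=\nabla\phi(\delta)$, $$p(n;x)=(2\pi n)^{-d/2}(\det B_s)^{-1/2}e^{-n\phi(\delta)}\,(2+E),\qquad |E|\le C\,n^{-1}(1-\|\delta\|_1)^{-2};$$ - if $\|x\|_1\not\equiv n\pmod 2$, then $p(n;x)=0$. -/

import Mathlib

noncomputable section

namespace SRW

/-- `n`-step transition function `p(n; x)` of the random walk on `ℤ^d` started at `0` with one-step
transition function `p`: `p(n+1; x) = ∑ y, p(n; y) p(x - y)`. -/
def transition {d : ℕ} (p : (Fin d → ℤ) → ℝ) : ℕ → (Fin d → ℤ) → ℝ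
  | 0 => fun x => if x = 0 then 1 else 0
  | n + 1 => fun x => ∑' y : Fin d → ℤ, transition p n y * p (x - y)

theorem transition_one {d : ℕ} (p : (Fin d → ℤ) → ℝ) : transition p 1 = p := by
  funext x
  simp only [transition]
  rw [tsum_eq_single 0 (fun y hy => by simp [hy])]
  simp

open Classical in
/-- One-step transition function of the simple random walk on `ℤ^d`:
`p(e_j) = p(-e_j) = 1 / (2d)` for each `j`, and `p(v) = 0` for all other `v`. -/
def step (d : ℕ) (v : Fin d → ℤ) : ℝ :=
  if ∃ j : Fin d, v = Pi.single j 1 ∨ v = -Pi.single j 1 then 1 / (2 * (d : ℝ)) else 0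

/-- The `ℓ¹` norm of a lattice point. -/
def latticeNorm1 {d : ℕ} (x : Fin d → ℤ) : ℤ := ∑ i, |x i|

/-- The `ℓ¹` norm on `ℝ^d`. -/
def norm1 {d : ℕ} (δ : EuclideanSpace ℝ (Fin d)) : ℝ := ∑ i, |δ i|

/-- `x / n` as a point of `ℝ^d`. -/
def drift {d : ℕ} (n : ℕ) (x : Fin d → ℤ) : EuclideanSpace ℝ (Fin d) :=
  WithLp.toLp 2 fun i => (x i : ℝ) / (n : ℝ)

/-- `κ(x) = (1/d) (cosh x_1 + ⋯ + cosh x_d)`. -/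
def kappa {d : ℕ} (x : EuclideanSpace ℝ (Fin d)) : ℝ :=
  1 / (d : ℝ) * ∑ i, Real.cosh (x i)

/-- `log κ`. -/
def logKappa {d : ℕ} (x : EuclideanSpace ℝ (Fin d)) : ℝ := Real.log (kappa x)

/-- `φ(δ) = sup_x (⟨x, δ⟩ - log κ(x))`; that the supremum is attained when `‖δ‖₁ < 1` is asserted
separately. -/
def phi {d : ℕ} (δ : EuclideanSpace ℝ (Fin d)) : ℝ :=
  sSup (Set.range fun x : EuclideanSpace ℝ (Fin d) => inner ℝ x δ - logKappa x)

/-- The bilinear form `B_x(u, w) = D_u D_w log κ (x)`, whose quadratic form is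
`B_x(u, u) = D_u² log κ (x)`. -/
def B {d : ℕ} (x u w : EuclideanSpace ℝ (Fin d)) : ℝ :=
  lineDeriv ℝ (fun y => lineDeriv ℝ logKappa y w) x u

/-- The matrix of `B_x` in the standard basis of `ℝ^d`. -/
def matB {d : ℕ} (x : EuclideanSpace ℝ (Fin d)) : Matrix (Fin d) (Fin d) ℝ :=
  Matrix.of fun i j => B x (EuclideanSpace.single i 1) (EuclideanSpace.single j 1)

end SRW

end

/-!
The proof is the saddle point method, arranged so that neither complex logarithms nor a
decomposition of the torus into neighbourhoods of critical points is needed.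

Let `s` be the maximiser of `⟨u, δ⟩ - log κ(u)`. It exists by coercivity (`legendre_le`), solves
`∇ log κ(s) = δ` (`sinh_saddle`), and this equation determines it (`eq_of_sinh_eq`); hence it
depends continuously on `δ` (`tendsto_saddle`) and is the gradient of `φ` (`hasGradientAt_phi`).

Fourier inversion along the contour `s + iθ` gives `p(n; x) = 2 (2π)^{-d} e^{-nφ(δ)} ∫ Re f(θ)^n dθ`
(`transition_eq_integral_re`), where `f` is the characteristic function of `v - δ` for the step `v`
distributed by the exponential tilt `q` at `s`; this has mean zero and covariance matrix `B_s`. By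
the parity of the walk the integral need only run over half of the torus, whence the factor `2`, and
the half may be chosen: `|θ_{j₀}| ≤ π/2` and `|θ_j| ≤ π` for the other `j`, where `±e_{j₀}` is a
step of weight at least `1/(2d)`. In this box the differences `⟨θ, v - v₀⟩` with the heavy step `v₀`
are at most `3π/2` in absolute value, where `1 - cos t ≥ t²/50`, so that
`|f(θ)| ≤ exp(-a B_s(θ,θ))` throughout (`norm_charSum_le`), with `a` depending only on `d`.

Writing `b = B_s(θ,θ)`, one has `b ≥ (1 - ‖δ‖₁)² |θ|² / d` (`dotProduct_matB_ge`), hence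
`⟨θ, v - δ⟩² ≤ K b` for all steps with `K = 4d (1 - ‖δ‖₁)^{-2}`. Therefore `f - e^{-b/2}` is the
imaginary third moment term plus `O(K b²)`, and `|f - e^{-b/2}|² = O(K b³)`. Expanding `f^n` to first
order around `e^{-nb/2}` and taking real parts, which removes the third moment, leaves an error
`O((K/n) e^{-a n b/2})` (`abs_re_charSum_pow_sub_exp_le`). Outside the box `K b ≥ 1`, so there the
Gaussian itself is of this size (`abs_indicator_sub_exp_le`). Integrating over `ℝ^d`, both the main
term and the error are multiples of `(2π/n)^{d/2} (det B_s)^{-1/2}` (`integral_exp_neg_posDef`).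
-/

noncomputable section

namespace SRW

open MeasureTheory Filter Topology

/-! ### Pointwise comparison of a power of a characteristic function with a Gaussian -/

theorem sq_div_fifty_le_one_sub_cos {t : ℝ} (ht : |t| ≤ 3 * Real.pi / 2) :
    t ^ 2 / 50 ≤ 1 - Real.cos t := by
  have hpi := Real.pi_gt_three
  have hpi4 := Real.pi_lt_d2
  have key : ∀ u : ℝ, 0 ≤ u → u ≤ 3 * Real.pi / 4 → u / 5 ≤ Real.sin u := by
    intro u hu0 hu
    rcases le_total u (Real.pi / 2) with h | h
    · refine le_trans ?_ (Real.mul_le_sin hu0 h)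
      rw [div_eq_inv_mul]
      refine mul_le_mul_of_nonneg_right ?_ hu0
      rw [le_div_iff₀ Real.pi_pos]; linarith
    · have h1 := Real.mul_le_sin (x := Real.pi - u) (by linarith) (by linarith)
      rw [Real.sin_pi_sub] at h1
      refine le_trans ?_ h1
      have h2 : 2 / Real.pi * (Real.pi / 4) ≤ 2 / Real.pi * (Real.pi - u) :=
        mul_le_mul_of_nonneg_left (by linarith) (by positivity)
      have h3 : 2 / Real.pi * (Real.pi / 4) = 1 / 2 := by field_simp; norm_num
      linarith
  have h1 := key (|t| / 2) (by positivity) (by linarith)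
  have h2 : Real.cos t = 1 - 2 * Real.sin (|t| / 2) ^ 2 := by
    have := Real.cos_two_mul' (|t| / 2)
    have h3 := Real.sin_sq_add_cos_sq (|t| / 2)
    rw [show 2 * (|t| / 2) = |t| by ring, Real.cos_abs] at this
    linarith
  have h3 : (|t| / 2 / 5) ^ 2 ≤ Real.sin (|t| / 2) ^ 2 := pow_le_pow_left₀ (by positivity) h1 2
  have h4 : (|t| / 2 / 5) ^ 2 = t ^ 2 / 100 := by rw [div_pow, div_pow, sq_abs]; ring
  linarith

theorem norm_exp_I_sub_taylor_le (x : ℝ) :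
    ‖Complex.exp (x * Complex.I) -
      (1 + x * Complex.I - x ^ 2 / 2 - x ^ 3 / 6 * Complex.I)‖ ≤ 4 * x ^ 4 := by
  have hI3 : Complex.I ^ 3 = -Complex.I := by rw [pow_succ, Complex.I_sq]; ring
  have hx4 : |x| ^ 4 = x ^ 4 := by
    rw [show |x| ^ 4 = (|x| ^ 2) ^ 2 by ring, sq_abs]; ring
  rcases le_total |x| 1 with h | h
  · have hn : ‖(x : ℂ) * Complex.I‖ = |x| := by simp
    have := Complex.exp_bound (x := x * Complex.I) (by rw [hn]; exact h) (n := 4) (by norm_num)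
    rw [hn, hx4] at this
    have e : ∑ m ∈ Finset.range 4, ((x : ℂ) * Complex.I) ^ m / (m.factorial : ℂ)
        = 1 + x * Complex.I - x ^ 2 / 2 - x ^ 3 / 6 * Complex.I := by
      simp only [Finset.sum_range_succ, Finset.sum_range_zero, mul_pow, hI3, Complex.I_sq,
        Nat.factorial]
      push_cast; ring
    rw [e] at this
    refine this.trans ?_
    rw [mul_comm]
    refine mul_le_mul_of_nonneg_right ?_ (by positivity)
    norm_num [Nat.factorial]
  · have h1 : ‖Complex.exp (x * Complex.I)‖ = 1 := Complex.norm_exp_ofReal_mul_I x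
    have hb : ‖Complex.exp (x * Complex.I) -
        (1 + x * Complex.I - x ^ 2 / 2 - x ^ 3 / 6 * Complex.I)‖
        ≤ 1 + (1 + |x| + |x| ^ 2 / 2 + |x| ^ 3 / 6) := by
      refine (norm_sub_le _ _).trans ?_
      rw [h1]
      gcongr
      refine (norm_sub_le _ _).trans ?_
      gcongr
      · refine (norm_sub_le _ _).trans ?_
        gcongr
        · refine (norm_add_le _ _).trans ?_
          simp
        · simp
      · simp
    refine hb.trans ?_
    rw [← hx4]
    have h0 : (1 : ℝ) ≤ |x| ^ 4 := one_le_pow₀ h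
    have h1' : |x| ≤ |x| ^ 4 := le_self_pow₀ h (by norm_num)
    have h2 : |x| ^ 2 ≤ |x| ^ 4 := pow_le_pow_right₀ h (by norm_num)
    have h3 : |x| ^ 3 ≤ |x| ^ 4 := pow_le_pow_right₀ h (by norm_num)
    linarith

theorem exp_neg_le_taylor {t : ℝ} (ht : 0 ≤ t) : Real.exp (-t) ≤ 1 - t + t ^ 2 / 2 := by
  have h1 := Real.quadratic_le_exp_of_nonneg ht
  have h2 : 0 < 1 - t + t ^ 2 / 2 := by nlinarith [sq_nonneg (t - 1)]
  have h3 : Real.exp (-t) * Real.exp t = 1 := by rw [← Real.exp_add]; simp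
  have h4 : (1 - t + t ^ 2 / 2) * (1 + t + t ^ 2 / 2) = 1 + t ^ 4 / 4 := by ring
  have h5 : (1 - t + t ^ 2 / 2) * (1 + t + t ^ 2 / 2) ≤ (1 - t + t ^ 2 / 2) * Real.exp t :=
    mul_le_mul_of_nonneg_left h1 h2.le
  have h6 : Real.exp (-t) * Real.exp t ≤ (1 - t + t ^ 2 / 2) * Real.exp t := by
    have : 0 ≤ t ^ 4 := by positivity
    linarith
  exact le_of_mul_le_mul_right h6 (Real.exp_pos t)

/-- First order expansion of `f ^ n` around `g ^ n`, with the error controlled by a common bound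
`M` for `‖f‖` and `‖g‖`. -/
theorem norm_pow_sub_pow_sub_le {f g : ℂ} {M : ℝ} (hf : ‖f‖ ≤ M) (hg : ‖g‖ ≤ M) (m : ℕ) :
    ‖f ^ (m + 2) - g ^ (m + 2) - (m + 2 : ℕ) * g ^ (m + 1) * (f - g)‖
      ≤ ((m + 2 : ℕ) : ℝ) ^ 2 * ‖f - g‖ ^ 2 * M ^ m := by
  have hM : 0 ≤ M := (norm_nonneg f).trans hf
  induction m with
  | zero =>
    have : f ^ (0 + 2) - g ^ (0 + 2) - ((0 + 2 : ℕ) : ℂ) * g ^ (0 + 1) * (f - g) = (f - g) ^ 2 := by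
      push_cast; ring
    rw [this, norm_pow]
    have := sq_nonneg ‖f - g‖
    simp only [pow_zero, mul_one]
    push_cast
    nlinarith
  | succ m ih =>
    have e : f ^ (m + 1 + 2) - g ^ (m + 1 + 2) - ((m + 1 + 2 : ℕ) : ℂ) * g ^ (m + 1 + 1) * (f - g)
        = f * (f ^ (m + 2) - g ^ (m + 2) - ((m + 2 : ℕ) : ℂ) * g ^ (m + 1) * (f - g))
          + ((m + 2 : ℕ) : ℂ) * g ^ (m + 1) * (f - g) ^ 2 := by
      push_cast; ring
    rw [e]
    refine (norm_add_le _ _).trans ?_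
    rw [norm_mul, norm_mul, norm_mul, norm_pow, norm_pow, Complex.norm_natCast]
    have h1 : ‖f‖ * ‖f ^ (m + 2) - g ^ (m + 2) - ((m + 2 : ℕ) : ℂ) * g ^ (m + 1) * (f - g)‖
        ≤ M * (((m + 2 : ℕ) : ℝ) ^ 2 * ‖f - g‖ ^ 2 * M ^ m) := by gcongr
    have h2 : ((m + 2 : ℕ) : ℝ) * ‖g‖ ^ (m + 1) * ‖f - g‖ ^ 2
        ≤ ((m + 2 : ℕ) : ℝ) * M ^ (m + 1) * ‖f - g‖ ^ 2 := by gcongr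
    refine (add_le_add h1 h2).trans ?_
    have h3 : 0 ≤ ‖f - g‖ ^ 2 * M ^ (m + 1) := by positivity
    have h4 : (((m + 2 : ℕ) : ℝ) ^ 2 + ((m + 2 : ℕ) : ℝ)) ≤ ((m + 1 + 2 : ℕ) : ℝ) ^ 2 := by
      push_cast; nlinarith [(Nat.cast_nonneg m : (0 : ℝ) ≤ m)]
    calc _ = (((m + 2 : ℕ) : ℝ) ^ 2 + ((m + 2 : ℕ) : ℝ)) * (‖f - g‖ ^ 2 * M ^ (m + 1)) := by ring
      _ ≤ ((m + 1 + 2 : ℕ) : ℝ) ^ 2 * (‖f - g‖ ^ 2 * M ^ (m + 1)) :=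
          mul_le_mul_of_nonneg_right h4 h3
      _ = _ := by ring

theorem pow_mul_exp_neg_le {a t : ℝ} (ha : 0 < a) (ht : 0 ≤ t) (k : ℕ) :
    t ^ k * Real.exp (-(a * t)) ≤ k.factorial * (2 * a⁻¹) ^ k * Real.exp (-(a / 2 * t)) := by
  have h1 := Real.pow_div_factorial_le_exp (a / 2 * t) (by positivity) k
  rw [div_le_iff₀ (by positivity), mul_pow] at h1
  have h2 : t ^ k = (2 * a⁻¹) ^ k * ((a / 2) ^ k * t ^ k) := by
    rw [← mul_assoc, ← mul_pow, show 2 * a⁻¹ * (a / 2) = 1 by field_simp, one_pow, one_mul]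
  have h3 : Real.exp (-(a * t)) = Real.exp (-(a / 2 * t)) * Real.exp (-(a / 2 * t)) := by
    rw [← Real.exp_add]; congr 1; ring
  have h4 : Real.exp (a / 2 * t) * Real.exp (-(a / 2 * t)) = 1 := by
    rw [← Real.exp_add]; simp
  rw [h3, h2]
  calc _ = (2 * a⁻¹) ^ k * ((a / 2) ^ k * t ^ k)
        * (Real.exp (-(a / 2 * t)) * Real.exp (-(a / 2 * t))) := by ring
    _ ≤ (2 * a⁻¹) ^ k * (Real.exp (a / 2 * t) * k.factorial)
          * (Real.exp (-(a / 2 * t)) * Real.exp (-(a / 2 * t))) := by gcongr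
    _ = (Real.exp (a / 2 * t) * Real.exp (-(a / 2 * t)))
          * (k.factorial * (2 * a⁻¹) ^ k * Real.exp (-(a / 2 * t))) := by ring
    _ = _ := by rw [h4, one_mul]

/-- The characteristic function `∑ v, q v * exp (i X v)` of a real random variable `X` on a finite
probability space with weights `q`. -/
def charSum {V : Type*} [Fintype V] (q X : V → ℝ) : ℂ :=
  ∑ v, (q v : ℂ) * Complex.exp (X v * Complex.I)

section charSum

variable {V : Type*} [Fintype V] {q X : V → ℝ} {b K : ℝ}

/-- Comparing all values with that of one atom `v₀`: the double sum
`1 - ‖f‖² = ∑ v w, q v * q w * (1 - cos (X v - X w))` is at least its row at `v₀`. -/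
theorem norm_charSum_le (hq : ∀ v, 0 ≤ q v) (hq1 : ∑ v, q v = 1) (hX1 : ∑ v, q v * X v = 0)
    (hX2 : ∑ v, q v * X v ^ 2 = b) (v₀ : V) (h₀ : ∀ v, |X v - X v₀| ≤ 3 * Real.pi / 2) :
    ‖charSum q X‖ ≤ Real.exp (-(q v₀ / 100 * b)) := by
  classical
  have hre : (charSum q X).re = ∑ v, q v * Real.cos (X v) := by
    simp [charSum, Complex.exp_ofReal_mul_I_re]
  have him : (charSum q X).im = ∑ v, q v * Real.sin (X v) := by
    simp [charSum, Complex.exp_ofReal_mul_I_im]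
  have hsq : ‖charSum q X‖ ^ 2 = ∑ v, ∑ w, q v * q w * Real.cos (X w - X v) := by
    rw [Complex.sq_norm, Complex.normSq_apply, hre, him, Finset.sum_mul_sum, Finset.sum_mul_sum,
      ← Finset.sum_add_distrib]
    refine Finset.sum_congr rfl fun v _ => ?_
    rw [← Finset.sum_add_distrib]
    refine Finset.sum_congr rfl fun w _ => ?_
    rw [Real.cos_sub]; ring
  have h1 : ∑ v, ∑ w, q v * q w = 1 := by
    rw [← Finset.sum_mul_sum, hq1, one_mul]
  have h2 : 1 - ‖charSum q X‖ ^ 2 = ∑ v, ∑ w, q v * q w * (1 - Real.cos (X w - X v)) := by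
    rw [hsq]
    nth_rewrite 1 [← h1]
    rw [← Finset.sum_sub_distrib]
    refine Finset.sum_congr rfl fun v _ => ?_
    rw [← Finset.sum_sub_distrib]
    refine Finset.sum_congr rfl fun w _ => ?_
    ring
  have h3 : ∑ w, q v₀ * q w * (1 - Real.cos (X w - X v₀)) ≤ 1 - ‖charSum q X‖ ^ 2 := by
    rw [h2]
    refine Finset.single_le_sum
      (f := fun v => ∑ w, q v * q w * (1 - Real.cos (X w - X v))) (fun v _ => ?_)
      (Finset.mem_univ v₀)
    refine Finset.sum_nonneg fun w _ => mul_nonneg (mul_nonneg (hq _) (hq _)) ?_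
    linarith [Real.cos_le_one (X w - X v)]
  have h4 : q v₀ / 50 * b ≤ ∑ w, q v₀ * q w * (1 - Real.cos (X w - X v₀)) := by
    have h5 : ∑ w, q w * (X w - X v₀) ^ 2 = b + X v₀ ^ 2 := by
      have : ∀ w, q w * (X w - X v₀) ^ 2
          = q w * X w ^ 2 - 2 * X v₀ * (q w * X w) + X v₀ ^ 2 * q w := fun w => by ring
      simp_rw [this]
      rw [Finset.sum_add_distrib, Finset.sum_sub_distrib, ← Finset.mul_sum, ← Finset.mul_sum,
        hX2, hX1, hq1]
      ring
    have h6 : ∑ w, q v₀ * q w * ((X w - X v₀) ^ 2 / 50)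
        ≤ ∑ w, q v₀ * q w * (1 - Real.cos (X w - X v₀)) :=
      Finset.sum_le_sum fun w _ => mul_le_mul_of_nonneg_left
        (sq_div_fifty_le_one_sub_cos (h₀ w)) (mul_nonneg (hq _) (hq _))
    refine le_trans ?_ h6
    have h7 : ∑ w, q v₀ * q w * ((X w - X v₀) ^ 2 / 50) = q v₀ / 50 * (b + X v₀ ^ 2) := by
      rw [← h5, Finset.mul_sum]
      exact Finset.sum_congr rfl fun w _ => by ring
    rw [h7]
    exact mul_le_mul_of_nonneg_left (by nlinarith [sq_nonneg (X v₀)]) (by linarith [hq v₀])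
  have h8 : ‖charSum q X‖ ^ 2 ≤ Real.exp (-(q v₀ / 100 * b)) ^ 2 := by
    rw [← Real.exp_nat_mul]
    have := Real.add_one_le_exp (-(q v₀ / 50 * b))
    push_cast
    rw [show 2 * -(q v₀ / 100 * b) = -(q v₀ / 50 * b) by ring]
    linarith
  exact (pow_le_pow_iff_left₀ (norm_nonneg _) (Real.exp_pos _).le two_ne_zero).1 h8

/-- Expansion of `charSum q X` around `exp (-b / 2)`: up to fourth moments, the difference is the
purely imaginary third moment term. -/
theorem norm_charSum_sub_exp_add_le (hq : ∀ v, 0 ≤ q v) (hq1 : ∑ v, q v = 1)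
    (hX1 : ∑ v, q v * X v = 0) (hX2 : ∑ v, q v * X v ^ 2 = b) :
    ‖charSum q X - Real.exp (-b / 2) + ((∑ v, q v * X v ^ 3) / 6 : ℝ) * Complex.I‖
      ≤ 4 * (∑ v, q v * X v ^ 4) + b ^ 2 / 8 := by
  have hb : 0 ≤ b := hX2 ▸ Finset.sum_nonneg fun v _ => mul_nonneg (hq v) (sq_nonneg _)
  have e1 : ∑ v, (q v : ℂ) * (1 + X v * Complex.I - X v ^ 2 / 2 - X v ^ 3 / 6 * Complex.I)
      = ((1 - b / 2 : ℝ) : ℂ) - ((∑ v, q v * X v ^ 3) / 6 : ℝ) * Complex.I := by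
    have : ∀ v, (q v : ℂ) * (1 + X v * Complex.I - X v ^ 2 / 2 - X v ^ 3 / 6 * Complex.I)
        = (q v : ℂ) + ((q v * X v : ℝ) : ℂ) * Complex.I - ((q v * X v ^ 2 : ℝ) : ℂ) / 2
          - ((q v * X v ^ 3 : ℝ) : ℂ) * (Complex.I / 6) := fun v => by push_cast; ring
    simp_rw [this]
    rw [Finset.sum_sub_distrib, Finset.sum_sub_distrib, Finset.sum_add_distrib, ← Finset.sum_mul,
      ← Finset.sum_mul, ← Finset.sum_div, ← Complex.ofReal_sum, ← Complex.ofReal_sum,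
      ← Complex.ofReal_sum, ← Complex.ofReal_sum, hq1, hX1, hX2]
    push_cast; ring
  have e2 : charSum q X - Real.exp (-b / 2) + ((∑ v, q v * X v ^ 3) / 6 : ℝ) * Complex.I
      = (∑ v, (q v : ℂ) * (Complex.exp (X v * Complex.I) -
          (1 + X v * Complex.I - X v ^ 2 / 2 - X v ^ 3 / 6 * Complex.I)))
        + ((1 - b / 2 - Real.exp (-b / 2) : ℝ) : ℂ) := by
    simp_rw [mul_sub (q _ : ℂ) (Complex.exp _)]
    rw [Finset.sum_sub_distrib, e1, charSum]
    push_cast; ring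
  rw [e2]
  refine (norm_add_le _ _).trans (add_le_add ?_ ?_)
  · refine (norm_sum_le _ _).trans ?_
    rw [Finset.mul_sum]
    refine Finset.sum_le_sum fun v _ => ?_
    rw [norm_mul, Complex.norm_real, Real.norm_of_nonneg (hq v)]
    calc _ ≤ q v * (4 * X v ^ 4) :=
          mul_le_mul_of_nonneg_left (norm_exp_I_sub_taylor_le (X v)) (hq v)
      _ = _ := by ring
  · rw [Complex.norm_real, Real.norm_eq_abs, abs_le]
    have h1 := exp_neg_le_taylor (t := b / 2) (by linarith)
    have h2 := Real.add_one_le_exp (-(b / 2))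
    rw [neg_div]
    constructor <;> nlinarith [sq_nonneg b]

/-- The power of the characteristic function of a centred variable of variance `b` is a Gaussian up
to a relative error of order `K / n`. Only the real part is compared: the third moment contributes
a purely imaginary term, which would otherwise be of order `√(K / n)`. The values of `X` are assumed
bounded by a constant, `√40 > 2π`. -/
theorem abs_re_charSum_pow_sub_exp_le (hq : ∀ v, 0 ≤ q v) (hq1 : ∑ v, q v = 1)
    (hX1 : ∑ v, q v * X v = 0) (hX2 : ∑ v, q v * X v ^ 2 = b) (hK : 1 ≤ K)
    (hXK : ∀ v, X v ^ 2 ≤ K * b) (hX40 : ∀ v, X v ^ 2 ≤ 40) {a : ℝ} (ha0 : 0 < a)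
    (ha : a ≤ 1 / 200) (hf : ‖charSum q X‖ ≤ Real.exp (-(a * b))) {n : ℕ} (hn : 1 ≤ n) :
    |((charSum q X) ^ n).re - Real.exp (-(n * b / 2))|
      ≤ 200000 * (K / n) * (a⁻¹) ^ 3 * Real.exp (-(a / 2 * (n * b))) := by
  set f := charSum q X with hf_def
  set m3 : ℝ := (∑ v, q v * X v ^ 3) / 6 with hm3
  set m4 : ℝ := ∑ v, q v * X v ^ 4 with hm4
  set G : ℝ := Real.exp (-b / 2) with hG
  have hb : 0 ≤ b := hX2 ▸ Finset.sum_nonneg fun v _ => mul_nonneg (hq v) (sq_nonneg _)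
  have hb40 : b ≤ 40 := by
    rw [← hX2]
    calc _ ≤ ∑ v, q v * 40 :=
          Finset.sum_le_sum fun v _ => mul_le_mul_of_nonneg_left (hX40 v) (hq v)
      _ = 40 := by rw [← Finset.sum_mul, hq1, one_mul]
  have hK0 : 0 ≤ K := by linarith
  have hm4K : m4 ≤ K * b ^ 2 := by
    calc m4 ≤ ∑ v, (K * b) * (q v * X v ^ 2) := Finset.sum_le_sum fun v _ => by
          have := mul_le_mul_of_nonneg_left (hXK v) (mul_nonneg (hq v) (sq_nonneg (X v)))
          calc _ = q v * X v ^ 2 * X v ^ 2 := by ring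
            _ ≤ _ := this
            _ = _ := by ring
      _ = K * b ^ 2 := by rw [← Finset.mul_sum, hX2]; ring
  have hm440 : m4 ≤ 40 * b := by
    calc m4 ≤ ∑ v, 40 * (q v * X v ^ 2) := Finset.sum_le_sum fun v _ => by
          have := mul_le_mul_of_nonneg_left (hX40 v) (mul_nonneg (hq v) (sq_nonneg (X v)))
          calc _ = q v * X v ^ 2 * X v ^ 2 := by ring
            _ ≤ _ := this
            _ = _ := by ring
      _ = 40 * b := by rw [← Finset.mul_sum, hX2]
  have hm40 : 0 ≤ m4 := Finset.sum_nonneg fun v _ => mul_nonneg (hq v) (by positivity)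
  have hm3sq : (6 * m3) ^ 2 ≤ K * b ^ 3 := by
    have hcs : (6 * m3) ^ 2 ≤ b * m4 := by
      rw [hm3, hm4, ← hX2, mul_div_cancel₀ _ (by norm_num : (6 : ℝ) ≠ 0)]
      refine Finset.sum_sq_le_sum_mul_sum_of_sq_le_mul _ (fun v _ => ?_) (fun v _ => ?_)
        (fun v _ => ?_)
      · exact mul_nonneg (hq v) (sq_nonneg _)
      · exact mul_nonneg (hq v) (by positivity)
      · exact le_of_eq (by ring)
    calc _ ≤ b * m4 := hcs
      _ ≤ b * (K * b ^ 2) := mul_le_mul_of_nonneg_left hm4K hb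
      _ = _ := by ring
  have hr := norm_charSum_sub_exp_add_le hq hq1 hX1 hX2
  rw [← hf_def, ← hm3, ← hm4, ← hG] at hr
  have hr5 : 4 * m4 + b ^ 2 / 8 ≤ 5 * K * b ^ 2 := by
    nlinarith [mul_le_mul_of_nonneg_right hK (sq_nonneg b)]
  have hre : |(f - G).re| ≤ 5 * K * b ^ 2 := by
    have h1 : (f - G).re = (f - G + m3 * Complex.I).re := by simp
    rw [h1]
    exact (Complex.abs_re_le_norm _).trans (hr.trans hr5)
  have hfg : ‖f - G‖ ^ 2 ≤ 2000 * K * b ^ 3 := by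
    have h1 : ‖f - G‖ ≤ (4 * m4 + b ^ 2 / 8) + |m3| := by
      have h2 : f - G = (f - G + m3 * Complex.I) - m3 * Complex.I := by ring
      rw [h2]
      refine (norm_sub_le _ _).trans (add_le_add hr ?_)
      simp
    have h2 : ‖f - G‖ ^ 2 ≤ ((4 * m4 + b ^ 2 / 8) + |m3|) ^ 2 :=
      pow_le_pow_left₀ (norm_nonneg _) h1 2
    have h3 : m4 ^ 2 ≤ 40 * (K * b ^ 3) := by
      calc m4 ^ 2 = m4 * m4 := sq _
        _ ≤ (K * b ^ 2) * (40 * b) := mul_le_mul hm4K hm440 hm40 (by positivity)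
        _ = _ := by ring
    have h4 : b ^ 4 ≤ 40 * (K * b ^ 3) := by
      have : b ^ 3 ≤ K * b ^ 3 := le_mul_of_one_le_left (by positivity) hK
      calc b ^ 4 = b * b ^ 3 := by ring
        _ ≤ 40 * (K * b ^ 3) := mul_le_mul hb40 this (by positivity) (by norm_num)
    have h5 : ((4 * m4 + b ^ 2 / 8) + |m3|) ^ 2 ≤ 3 * (16 * m4 ^ 2 + b ^ 4 / 64 + m3 ^ 2) := by
      rw [← sq_abs m3]
      nlinarith [sq_nonneg (4 * m4 - b ^ 2 / 8), sq_nonneg (4 * m4 - |m3|),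
        sq_nonneg (b ^ 2 / 8 - |m3|)]
    nlinarith
  -- Powers `n - 1` and `n - 2` may be replaced by `n` at the cost of a factor `2`.
  have hexp2 : ∀ c : ℝ, c ≤ 2 → Real.exp (a * c * b) ≤ 2 := by
    intro c hc
    have h1 : a * c * b ≤ 0.4 := by
      have : a * b ≤ 1 / 200 * 40 := mul_le_mul ha hb40 hb (by norm_num)
      nlinarith [mul_nonneg ha0.le hb]
    refine (Real.exp_le_exp.2 h1).trans ?_
    have h2 : Real.exp 0.4 ^ 2 ≤ 2 ^ 2 := by
      rw [← Real.exp_nat_mul]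
      refine (Real.exp_le_exp.2 (by norm_num : ((2 : ℕ) : ℝ) * 0.4 ≤ 1)).trans ?_
      linarith [Real.exp_one_lt_d9]
    exact (pow_le_pow_iff_left₀ (Real.exp_pos _).le (by norm_num) two_ne_zero).1 h2
  set M : ℝ := Real.exp (-(a * b)) with hM
  have hGM : G ≤ M := by
    refine Real.exp_le_exp.2 ?_
    nlinarith
  set E : ℝ := Real.exp (-(a * (n * b))) with hE
  have hG1 : G ^ (n - 1) ≤ 2 * E := by
    calc G ^ (n - 1) ≤ M ^ (n - 1) := pow_le_pow_left₀ (Real.exp_pos _).le hGM _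
      _ = Real.exp (a * 1 * b) * E := by
        rw [hM, hE, ← Real.exp_nat_mul, ← Real.exp_add, Nat.cast_sub hn]
        congr 1; push_cast; ring
      _ ≤ 2 * E := mul_le_mul_of_nonneg_right (hexp2 1 (by norm_num)) (Real.exp_pos _).le
  have hD : ‖f ^ n - (G : ℂ) ^ n - n * (G : ℂ) ^ (n - 1) * (f - G)‖
      ≤ (n : ℝ) ^ 2 * (2000 * K * b ^ 3) * (2 * E) := by
    obtain rfl | ⟨m, rfl⟩ : n = 1 ∨ ∃ m, n = m + 2 := by
      rcases n with _ | _ | m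
      · omega
      · exact Or.inl rfl
      · exact Or.inr ⟨m, rfl⟩
    · have : f ^ 1 - (G : ℂ) ^ 1 - ((1 : ℕ) : ℂ) * (G : ℂ) ^ (1 - 1) * (f - G) = 0 := by simp
      rw [this, norm_zero]
      positivity
    · have hGn : ‖(G : ℂ)‖ ≤ M := by
        rw [Complex.norm_real, Real.norm_of_nonneg (Real.exp_pos _).le]; exact hGM
      refine (norm_pow_sub_pow_sub_le hf hGn m).trans ?_
      have hMm : M ^ m ≤ 2 * E := by
        calc M ^ m = Real.exp (a * 2 * b) * E := by
              rw [hM, hE, ← Real.exp_nat_mul, ← Real.exp_add]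
              congr 1; push_cast; ring
          _ ≤ 2 * E := mul_le_mul_of_nonneg_right (hexp2 2 le_rfl) (Real.exp_pos _).le
      have hM0 : 0 ≤ M := (Real.exp_pos _).le
      gcongr
  have hGn : Real.exp (-(n * b / 2)) = G ^ n := by
    rw [hG, ← Real.exp_nat_mul]; congr 1; ring
  have hsplit : (f ^ n).re - G ^ n
      = (f ^ n - (G : ℂ) ^ n - n * (G : ℂ) ^ (n - 1) * (f - G)).re
        + n * G ^ (n - 1) * (f - G).re := by
    have h1 : ((n : ℂ) * (G : ℂ) ^ (n - 1) * (f - G)).re = n * G ^ (n - 1) * (f - G).re := by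
      rw [← Complex.re_ofReal_mul]; push_cast; rfl
    have h2 : ((G : ℂ) ^ n).re = G ^ n := by rw [← Complex.ofReal_pow, Complex.ofReal_re]
    rw [Complex.sub_re, Complex.sub_re, h1, h2]; ring
  have hn0 : (0 : ℝ) < n := by exact_mod_cast hn
  have hbound : |(f ^ n).re - G ^ n|
      ≤ (n : ℝ) ^ 2 * (2000 * K * b ^ 3) * (2 * E) + n * (2 * E) * (5 * K * b ^ 2) := by
    rw [hsplit]
    refine (abs_add_le _ _).trans (add_le_add ((Complex.abs_re_le_norm _).trans hD) ?_)
    rw [abs_mul, abs_of_nonneg (by positivity : (0 : ℝ) ≤ n * G ^ (n - 1))]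
    exact mul_le_mul (mul_le_mul_of_nonneg_left hG1 hn0.le) hre (abs_nonneg _) (by positivity)
  rw [hGn]
  refine hbound.trans ?_
  set t : ℝ := n * b with ht
  have ht0 : 0 ≤ t := by positivity
  set F : ℝ := Real.exp (-(a / 2 * t)) with hF
  have h5 : 4000 * (t ^ 3 * E) + 10 * (t ^ 2 * E) ≤ 200000 * (a⁻¹ ^ 3 * F) := by
    have h2 := pow_mul_exp_neg_le ha0 ht0 2
    have h3 := pow_mul_exp_neg_le ha0 ht0 3
    rw [← hE, ← hF] at h2 h3
    have hai : 200 ≤ a⁻¹ := by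
      rw [le_inv_comm₀ (by norm_num) ha0]; linarith
    have hF0 : 0 ≤ F := (Real.exp_pos _).le
    have h4 : a⁻¹ ^ 2 * F ≤ a⁻¹ ^ 3 * F :=
      mul_le_mul_of_nonneg_right (pow_le_pow_right₀ (by linarith) (by norm_num)) hF0
    have h6 : 0 ≤ a⁻¹ ^ 3 * F := by positivity
    have e2 : ((2 : ℕ).factorial : ℝ) * (2 * a⁻¹) ^ 2 * F = 8 * (a⁻¹ ^ 2 * F) := by
      norm_num [Nat.factorial]; ring
    have e3 : ((3 : ℕ).factorial : ℝ) * (2 * a⁻¹) ^ 3 * F = 48 * (a⁻¹ ^ 3 * F) := by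
      norm_num [Nat.factorial]; ring
    rw [e2] at h2
    rw [e3] at h3
    linarith
  calc _ = (K / n) * (4000 * (t ^ 3 * E) + 10 * (t ^ 2 * E)) := by
        rw [ht]; field_simp; ring
    _ ≤ (K / n) * (200000 * (a⁻¹ ^ 3 * F)) := mul_le_mul_of_nonneg_left h5 (by positivity)
    _ = _ := by ring

end charSum

/-! ### Gaussian integrals -/

open scoped MatrixOrder in
theorem exists_transpose_mul_self_of_posDef {d : ℕ} {A : Matrix (Fin d) (Fin d) ℝ}
    (hA : A.PosDef) : ∃ Y : Matrix (Fin d) (Fin d) ℝ, IsUnit Y ∧ A = Y.transpose * Y := by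
  obtain ⟨Y, hY, h⟩ := CStarAlgebra.isStrictlyPositive_iff_eq_star_mul_self.mp
    hA.isStrictlyPositive
  refine ⟨Y, hY, ?_⟩
  rw [h, Matrix.star_eq_conjTranspose, Matrix.conjTranspose_eq_transpose_of_trivial]

theorem integral_exp_neg_sum_sq (d : ℕ) {t : ℝ} (ht : 0 < t) :
    Integrable (fun x : Fin d → ℝ => Real.exp (-(t * ∑ i, x i ^ 2))) ∧
    ∫ x : Fin d → ℝ, Real.exp (-(t * ∑ i, x i ^ 2)) = (Real.pi / t) ^ ((d : ℝ) / 2) := by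
  have h : (fun x : Fin d → ℝ => Real.exp (-(t * ∑ i, x i ^ 2)))
      = fun x => ∏ i, Real.exp (-t * x i ^ 2) := by
    funext x
    rw [← Real.exp_sum, Finset.mul_sum, ← Finset.sum_neg_distrib]
    simp
  rw [h]
  refine ⟨Integrable.fintype_prod (f := fun _ x => Real.exp (-t * x ^ 2))
    fun _ => integrable_exp_neg_mul_sq ht, ?_⟩
  rw [integral_fintype_prod_volume_eq_pow (fun x : ℝ => Real.exp (-t * x ^ 2)), integral_gaussian,
    Fintype.card_fin, Real.sqrt_eq_rpow, ← Real.rpow_natCast, ← Real.rpow_mul (by positivity)]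
  congr 1; ring

theorem integral_exp_neg_posDef {d : ℕ} {A : Matrix (Fin d) (Fin d) ℝ} (hA : A.PosDef) {t : ℝ}
    (ht : 0 < t) :
    Integrable (fun x : Fin d → ℝ => Real.exp (-(t * dotProduct x (A.mulVec x)))) ∧
    ∫ x : Fin d → ℝ, Real.exp (-(t * dotProduct x (A.mulVec x)))
      = (Real.pi / t) ^ ((d : ℝ) / 2) * A.det ^ (-(1 / 2 : ℝ)) := by
  obtain ⟨Y, hY, rfl⟩ := exists_transpose_mul_self_of_posDef hA
  have hdet : Y.det ≠ 0 := ((Matrix.isUnit_iff_isUnit_det Y).1 hY).ne_zero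
  have hfun : (fun x : Fin d → ℝ => Real.exp (-(t * dotProduct x ((Y.transpose * Y).mulVec x))))
      = (fun x : Fin d → ℝ => Real.exp (-(t * ∑ i, x i ^ 2))) ∘ Matrix.toLin' Y := by
    funext x
    simp only [Function.comp, Matrix.toLin'_apply]
    rw [← Matrix.mulVec_mulVec, Matrix.dotProduct_mulVec, Matrix.vecMul_transpose]
    simp [dotProduct, sq]
  have hmap := Real.map_matrix_volume_pi_eq_smul_volume_pi hdet
  have hemb : MeasurableEmbedding (Matrix.toLin' Y) :=
    (LinearMap.continuous_on_pi _).measurableEmbedding (Matrix.mulVec_injective_of_isUnit hY)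
  obtain ⟨hi, hv⟩ := integral_exp_neg_sum_sq d ht
  rw [hfun]
  constructor
  · rw [← hemb.integrable_map_iff, hmap]
    exact hi.smul_measure ENNReal.ofReal_ne_top
  · have := hemb.integral_map (μ := volume) (fun x : Fin d → ℝ => Real.exp (-(t * ∑ i, x i ^ 2)))
    rw [Function.comp_def, ← this, hmap, integral_smul_measure, hv,
      ENNReal.toReal_ofReal (abs_nonneg _), smul_eq_mul, mul_comm]
    congr 1
    rw [Matrix.det_mul, Matrix.det_transpose, abs_inv, Real.rpow_neg (mul_self_nonneg _),
      ← Real.sqrt_eq_rpow, Real.sqrt_mul_self_eq_abs]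

/-! ### The walk and its Fourier representation -/

/-- The `2d` steps `± e_j` of the walk, the sign `+` being encoded by `true`. -/
def stepVec {d : ℕ} (v : Fin d × Bool) : Fin d → ℤ := Pi.single v.1 (if v.2 then 1 else -1)

theorem stepVec_injective {d : ℕ} : Function.Injective (stepVec (d := d)) := by
  rintro ⟨i, a⟩ ⟨j, b⟩ h
  have hi := congrFun h i
  obtain rfl : i = j := by
    by_contra hij
    simp only [stepVec, Pi.single_eq_same, Pi.single_eq_of_ne hij] at hi
    cases a <;> simp at hi
  simp only [stepVec, Pi.single_eq_same] at hi
  cases a <;> cases b <;> simp_all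

theorem step_eq_sum {d : ℕ} (w : Fin d → ℤ) :
    step d w = ∑ v : Fin d × Bool, if w = stepVec v then 1 / (2 * (d : ℝ)) else 0 := by
  classical
  rw [step]
  split_ifs with h
  · obtain ⟨v, hv⟩ : ∃ v : Fin d × Bool, w = stepVec v := by
      obtain ⟨j, rfl | rfl⟩ := h
      · exact ⟨(j, true), by simp [stepVec]⟩
      · exact ⟨(j, false), by simp [stepVec, Pi.single_neg]⟩
    rw [Finset.sum_eq_single v, if_pos hv]
    · intro u _ huv
      rw [if_neg]
      intro hu
      exact huv (stepVec_injective (hu.symm.trans hv))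
    · simp
  · symm
    refine Finset.sum_eq_zero fun v _ => if_neg fun hv => h ⟨v.1, ?_⟩
    rw [hv]
    rcases v with ⟨j, _ | _⟩
    · right; simp [stepVec, Pi.single_neg]
    · left; simp [stepVec]

theorem transition_succ {d : ℕ} (n : ℕ) (x : Fin d → ℤ) :
    transition (step d) (n + 1) x
      = 1 / (2 * (d : ℝ)) * ∑ v : Fin d × Bool, transition (step d) n (x - stepVec v) := by
  simp only [transition]
  simp_rw [step_eq_sum, Finset.mul_sum]
  have hs : ∀ v : Fin d × Bool, ∀ y, y ≠ x - stepVec v →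
      transition (step d) n y * (if x - y = stepVec v then 1 / (2 * (d : ℝ)) else 0) = 0 := by
    intro v y hy
    rw [if_neg, mul_zero]
    intro h
    exact hy (by rw [← h]; abel)
  rw [Summable.tsum_finsetSum fun v _ =>
    summable_of_ne_finset_zero (s := {x - stepVec v}) fun y hy => hs v y (by simpa using hy)]
  refine Finset.sum_congr rfl fun v _ => ?_
  rw [tsum_eq_single _ (hs v)]
  simp [mul_comm]

theorem sum_stepVec {d : ℕ} (v : Fin d × Bool) : ∑ i, stepVec v i ≡ 1 [ZMOD 2] := by
  rcases v with ⟨j, _ | _⟩ <;> simp [stepVec]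
  decide

theorem latticeNorm1_modEq {d : ℕ} (x : Fin d → ℤ) : latticeNorm1 x ≡ ∑ i, x i [ZMOD 2] := by
  refine (Int.ModEq.sum fun i _ => ?_)
  rcases abs_choice (x i) with h | h <;> rw [h]
  rw [Int.modEq_iff_dvd]
  exact ⟨x i, by ring⟩

theorem transition_eq_zero {d : ℕ} (n : ℕ) (x : Fin d → ℤ) (h : ¬ ∑ i, x i ≡ (n : ℤ) [ZMOD 2]) :
    transition (step d) n x = 0 := by
  induction n generalizing x with
  | zero =>
    simp only [transition]
    rw [if_neg]
    rintro rfl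
    exact h (by simp)
  | succ n ih =>
    rw [transition_succ, Finset.sum_eq_zero, mul_zero]
    intro v _
    refine ih _ fun hv => h ?_
    have := hv.add (sum_stepVec v)
    rw [← Finset.sum_add_distrib] at this
    simpa using this

/-- Half the length of the `j`-th side of `halfBox j₀`: `π/2` for `j = j₀`, `π` otherwise. -/
def halfWidth {d : ℕ} (j₀ j : Fin d) : ℝ := if j = j₀ then Real.pi / 2 else Real.pi

/-- A box of half the volume of the torus `(ℝ / 2πℤ)^d`: the coordinate `j₀` runs over
`(-π/2, π/2]`, the others over `(-π, π]`. It is a fundamental domain for the translations by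
`2πℤ^d` together with `(π, …, π)`, which leave `κ(i·)^n` invariant up to sign. -/
def halfBox {d : ℕ} (j₀ : Fin d) : Set (Fin d → ℝ) :=
  Set.univ.pi fun j => Set.Ioc (-halfWidth j₀ j) (halfWidth j₀ j)

theorem halfWidth_nonneg {d : ℕ} (j₀ j : Fin d) : 0 ≤ halfWidth j₀ j := by
  unfold halfWidth; split_ifs <;> positivity

theorem integral_cexp_symm (h : ℝ) (hh : 0 ≤ h) (m : ℤ) :
    ∫ t in Set.Ioc (-h) h, Complex.exp (-(t * Complex.I * m))
      = if m = 0 then (2 * h : ℂ) else 2 * Complex.sin (m * h) / m := by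
  rw [← intervalIntegral.integral_of_le (by linarith)]
  split_ifs with hm
  · subst hm
    simp
    ring
  · have hm' : (m : ℂ) ≠ 0 := by exact_mod_cast hm
    have hc : -(Complex.I * m) ≠ 0 := neg_ne_zero.2 (mul_ne_zero Complex.I_ne_zero hm')
    have := integral_exp_mul_complex (a := -h) (b := h) hc
    rw [show (fun t : ℝ => Complex.exp (-(t * Complex.I * m)))
      = fun t : ℝ => Complex.exp (-(Complex.I * m) * t) by funext t; congr 1; ring, this,
      Complex.sin]
    have hI := Complex.I_ne_zero
    field_simp
    rw [Complex.I_sq]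
    push_cast
    rw [mul_neg, neg_neg]
    ring

/-- Orthogonality of the even characters on the half torus. -/
theorem integral_halfBox_character {d : ℕ} (j₀ : Fin d) (x : Fin d → ℤ)
    (hx : ∑ i, x i ≡ 0 [ZMOD 2]) :
    ∫ θ in halfBox j₀, Complex.exp (-∑ j, (θ j * Complex.I) * x j)
      = if x = 0 then ((2 * Real.pi) ^ d / 2 : ℂ) else 0 := by
  have h1 : (fun θ : Fin d → ℝ => Complex.exp (-∑ j, (θ j * Complex.I) * x j))
      = fun θ => ∏ j, Complex.exp (-(θ j * Complex.I * x j)) := by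
    funext θ
    rw [← Complex.exp_sum, Finset.sum_neg_distrib]
  have h2 : (volume : Measure (Fin d → ℝ)).restrict (halfBox j₀)
      = Measure.pi fun j => volume.restrict (Set.Ioc (-halfWidth j₀ j) (halfWidth j₀ j)) := by
    rw [halfBox, volume_pi, Measure.restrict_pi_pi]
  rw [h1, h2, integral_fintype_prod_eq_prod
    (fun j (t : ℝ) => Complex.exp (-(t * Complex.I * x j)))]
  simp_rw [integral_cexp_symm _ (halfWidth_nonneg j₀ _)]
  split_ifs with h
  · subst h
    simp only [Pi.zero_apply, if_true]
    rw [← Finset.mul_prod_erase _ _ (Finset.mem_univ j₀)]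
    have : ∏ j ∈ Finset.univ.erase j₀, (2 * (halfWidth j₀ j : ℂ)) = (2 * Real.pi) ^ (d - 1) := by
      rw [Finset.prod_congr rfl (g := fun _ => (2 * (Real.pi : ℂ)))]
      · simp
      · intro j hj
        rw [halfWidth, if_neg (Finset.ne_of_mem_erase hj)]
    rw [this, halfWidth, if_pos rfl]
    obtain ⟨e, rfl⟩ : ∃ e, d = e + 1 := ⟨d - 1, by have := j₀.pos; omega⟩
    simp only [Nat.add_sub_cancel]
    push_cast
    ring
  · by_cases h' : ∃ j, j ≠ j₀ ∧ x j ≠ 0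
    · obtain ⟨j, hj, hxj⟩ := h'
      refine Finset.prod_eq_zero (Finset.mem_univ j) ?_
      rw [if_neg hxj, halfWidth, if_neg hj, Complex.sin_int_mul_pi]
      simp
    · push Not at h'
      have hx0 : x j₀ ≠ 0 := fun h0 => h (funext fun j => by
        by_cases hj : j = j₀
        · rw [hj]; exact h0
        · exact h' j hj)
      rw [Finset.sum_eq_single j₀ (fun j _ hj => h' j hj) (by simp)] at hx
      obtain ⟨k, hk⟩ := (Int.modEq_zero_iff_dvd.1 hx)
      refine Finset.prod_eq_zero (Finset.mem_univ j₀) ?_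
      rw [if_neg hx0, halfWidth, if_pos rfl, hk]
      have : (((2 * k : ℤ) : ℂ)) * ((Real.pi / 2 : ℝ) : ℂ) = k * Real.pi := by push_cast; ring
      rw [this, Complex.sin_int_mul_pi]
      simp

theorem integrableOn_halfBox {d : ℕ} (j₀ : Fin d) {E : Type*} [NormedAddCommGroup E]
    {F : (Fin d → ℝ) → E} (hF : Continuous F) : IntegrableOn F (halfBox j₀) := by
  refine (hF.continuousOn.integrableOn_compact (μ := volume)
    (isCompact_univ_pi fun j => isCompact_Icc
      (a := -halfWidth j₀ j) (b := halfWidth j₀ j))).mono_set ?_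
  exact Set.pi_mono fun j _ => Set.Ioc_subset_Icc_self

/-- The Laplace transform `∑ v, exp ⟨z, v⟩ / (2d)` of one step, `κ` continued to `ℂ^d`. -/
def laplace {d : ℕ} (z : Fin d → ℂ) : ℂ :=
  1 / (2 * (d : ℂ)) * ∑ v : Fin d × Bool, Complex.exp (∑ j, z j * stepVec v j)

/-- Fourier inversion on the half torus, along the contour shifted to real part `s`. -/
theorem transition_eq_integral {d : ℕ} (j₀ : Fin d) (s : Fin d → ℝ) (n : ℕ) (x : Fin d → ℤ)
    (hx : ∑ i, x i ≡ (n : ℤ) [ZMOD 2]) :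
    (transition (step d) n x : ℂ) = 2 / (2 * Real.pi) ^ d *
      ∫ θ in halfBox j₀, laplace (fun j => s j + θ j * Complex.I) ^ n *
        Complex.exp (-∑ j, (s j + θ j * Complex.I) * x j) := by
  induction n generalizing x with
  | zero =>
    have h1 : (fun θ : Fin d → ℝ => laplace (fun j => s j + θ j * Complex.I) ^ 0 *
        Complex.exp (-∑ j, (s j + θ j * Complex.I) * x j))
        = fun θ => Complex.exp (-∑ j, (s j : ℂ) * x j)
          * Complex.exp (-∑ j, (θ j * Complex.I) * x j) := by
      funext θ
      rw [pow_zero, one_mul, ← Complex.exp_add, ← neg_add, ← Finset.sum_add_distrib]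
      simp_rw [add_mul]
    rw [h1, integral_const_mul, integral_halfBox_character j₀ x (by simpa using hx)]
    simp only [transition]
    split_ifs with h
    · subst h
      have : (2 * (Real.pi : ℂ)) ^ d ≠ 0 := by
        refine pow_ne_zero _ (mul_ne_zero two_ne_zero ?_)
        exact_mod_cast Real.pi_ne_zero
      simp only [Pi.zero_apply, Int.cast_zero, mul_zero, Finset.sum_const_zero, neg_zero,
        Complex.exp_zero, one_mul, Complex.ofReal_one]
      field_simp
    · simp
  | succ n ih =>
    have hpt : ∀ θ : Fin d → ℝ, laplace (fun j => s j + θ j * Complex.I) ^ (n + 1) *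
        Complex.exp (-∑ j, (s j + θ j * Complex.I) * x j)
        = 1 / (2 * (d : ℂ)) * ∑ v : Fin d × Bool, laplace (fun j => s j + θ j * Complex.I) ^ n *
          Complex.exp (-∑ j, (s j + θ j * Complex.I) * ((x - stepVec v) j : ℤ)) := by
      intro θ
      set L := laplace (fun j => s j + θ j * Complex.I) ^ n with hL
      rw [pow_succ, ← hL, laplace, mul_assoc, mul_assoc, mul_left_comm, Finset.sum_mul,
        Finset.mul_sum]
      congr 1
      refine Finset.sum_congr rfl fun v _ => ?_
      rw [← Complex.exp_add]
      congr 2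
      rw [← Finset.sum_neg_distrib, ← Finset.sum_neg_distrib, ← Finset.sum_add_distrib]
      refine Finset.sum_congr rfl fun j _ => ?_
      simp only [Pi.sub_apply]
      push_cast
      ring
    simp_rw [hpt]
    rw [integral_const_mul, integral_finsetSum, transition_succ]
    · push_cast
      rw [mul_left_comm]
      congr 1
      rw [Finset.mul_sum]
      refine Finset.sum_congr rfl fun v _ => ?_
      rw [ih]
      have := hx.sub (sum_stepVec v)
      rw [← Finset.sum_sub_distrib] at this
      simpa using this
    · intro v _
      refine integrableOn_halfBox j₀ ?_
      unfold laplace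
      fun_prop

/-! ### The Legendre transform of `log κ` -/

/-- `∑ i, cosh (u i) = d κ(u)`. -/
def coshSum {d : ℕ} (u : EuclideanSpace ℝ (Fin d)) : ℝ := ∑ i, Real.cosh (u i)

theorem coshSum_pos {d : ℕ} (hd : 1 ≤ d) (u : EuclideanSpace ℝ (Fin d)) : 0 < coshSum u :=
  Finset.sum_pos (fun _ _ => Real.cosh_pos _) ⟨⟨0, hd⟩, Finset.mem_univ _⟩

theorem kappa_eq {d : ℕ} (u : EuclideanSpace ℝ (Fin d)) : kappa u = 1 / (d : ℝ) * coshSum u := rfl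

theorem kappa_pos {d : ℕ} (hd : 1 ≤ d) (u : EuclideanSpace ℝ (Fin d)) : 0 < kappa u := by
  have : (0 : ℝ) < d := by exact_mod_cast hd
  exact mul_pos (by positivity) (coshSum_pos hd u)

theorem hasDerivAt_add_smul_apply {d : ℕ} (y w : EuclideanSpace ℝ (Fin d)) (i : Fin d) :
    HasDerivAt (fun t : ℝ => (y + t • w) i) (w i) 0 := by
  have : (fun t : ℝ => (y + t • w) i) = fun t => y i + t * w i := by funext t; simp
  rw [this]
  simpa using ((hasDerivAt_id (0 : ℝ)).mul_const (w i)).const_add (y i)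

theorem hasDerivAt_coshSum {d : ℕ} (y w : EuclideanSpace ℝ (Fin d)) :
    HasDerivAt (fun t : ℝ => coshSum (y + t • w)) (∑ i, Real.sinh (y i) * w i) 0 := by
  have := HasDerivAt.fun_sum (u := Finset.univ)
    fun i _ => (hasDerivAt_add_smul_apply y w i).cosh
  simpa [coshSum] using this

theorem hasDerivAt_sum_sinh {d : ℕ} (y u w : EuclideanSpace ℝ (Fin d)) :
    HasDerivAt (fun t : ℝ => ∑ i, Real.sinh ((y + t • u) i) * w i)
      (∑ i, Real.cosh (y i) * u i * w i) 0 := by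
  have := HasDerivAt.fun_sum (u := Finset.univ)
    fun i _ => ((hasDerivAt_add_smul_apply y u i).sinh).mul_const (w i)
  simpa using this

theorem hasDerivAt_logKappa {d : ℕ} (hd : 1 ≤ d) (y w : EuclideanSpace ℝ (Fin d)) :
    HasDerivAt (fun t : ℝ => logKappa (y + t • w))
      ((∑ i, Real.sinh (y i) * w i) / coshSum y) 0 := by
  have h0 : kappa (y + (0 : ℝ) • w) ≠ 0 := (kappa_pos hd _).ne'
  have := ((hasDerivAt_coshSum y w).const_mul (1 / (d : ℝ))).log h0
  refine this.congr_deriv ?_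
  have hd' : (d : ℝ) ≠ 0 := by have : 0 < d := hd; positivity
  have hS := (coshSum_pos hd y).ne'
  rw [zero_smul, add_zero]
  field_simp

theorem B_apply {d : ℕ} (hd : 1 ≤ d) (x u w : EuclideanSpace ℝ (Fin d)) :
    B x u w = (∑ i, Real.cosh (x i) * u i * w i) / coshSum x
      - (∑ i, Real.sinh (x i) * u i) / coshSum x * ((∑ i, Real.sinh (x i) * w i) / coshSum x) := by
  have h1 : (fun y => lineDeriv ℝ logKappa y w)
      = fun y : EuclideanSpace ℝ (Fin d) => (∑ i, Real.sinh (y i) * w i) / coshSum y :=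
    funext fun y => (hasDerivAt_logKappa hd y w).deriv
  rw [B, h1]
  have h0 : coshSum (x + (0 : ℝ) • u) ≠ 0 := (coshSum_pos hd _).ne'
  have := ((hasDerivAt_sum_sinh x u w).div (hasDerivAt_coshSum x u) h0).deriv
  refine Eq.trans this ?_
  have hS := (coshSum_pos hd x).ne'
  rw [zero_smul, add_zero]
  field_simp

/-- The function `u ↦ ⟨u, δ⟩ - log κ(u)` whose maximum is `φ(δ)`. -/
def legendre {d : ℕ} (δ u : EuclideanSpace ℝ (Fin d)) : ℝ := inner ℝ u δ - logKappa u

theorem inner_eq_sum {d : ℕ} (u δ : EuclideanSpace ℝ (Fin d)) : inner ℝ u δ = ∑ i, u i * δ i := by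
  rw [PiLp.inner_apply]
  exact Finset.sum_congr rfl fun i _ => by simp [mul_comm]

theorem continuous_coshSum {d : ℕ} : Continuous (coshSum (d := d)) := by
  unfold coshSum
  exact continuous_finsetSum _ fun i _ => Real.continuous_cosh.comp (by fun_prop)

theorem continuous_norm1 {d : ℕ} : Continuous (norm1 (d := d)) := by
  unfold norm1
  fun_prop

theorem continuous_legendre {d : ℕ} (hd : 1 ≤ d) (δ : EuclideanSpace ℝ (Fin d)) :
    Continuous (legendre δ) := by
  unfold legendre logKappa
  refine Continuous.sub (by fun_prop) (Continuous.log ?_ fun u => (kappa_pos hd u).ne')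
  exact continuous_const.mul continuous_coshSum

theorem legendre_zero {d : ℕ} (hd : 1 ≤ d) (δ : EuclideanSpace ℝ (Fin d)) : legendre δ 0 = 0 := by
  have hd' : (d : ℝ) ≠ 0 := by have : 0 < d := hd; positivity
  simp [legendre, logKappa, kappa, hd']

/-- Coercivity: `⟨u, δ⟩ ≤ ‖δ‖₁ ‖u‖_∞` while `log κ(u) ≥ ‖u‖_∞ - log (2d)`. -/
theorem legendre_le {d : ℕ} (hd : 1 ≤ d) {δ : EuclideanSpace ℝ (Fin d)} (hδ : norm1 δ < 1)
    (u : EuclideanSpace ℝ (Fin d)) :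
    legendre δ u ≤ Real.log (2 * d) - (1 - norm1 δ) * (‖u‖ / d) := by
  have hd0 : (0 : ℝ) < d := by exact_mod_cast hd
  have : Nonempty (Fin d) := ⟨⟨0, hd⟩⟩
  obtain ⟨j, hj⟩ := Finite.exists_max fun i => |u i|
  have h1 : inner ℝ u δ ≤ norm1 δ * |u j| := by
    rw [inner_eq_sum, norm1, Finset.sum_mul]
    refine Finset.sum_le_sum fun i _ => ?_
    refine (le_abs_self _).trans ?_
    rw [abs_mul, mul_comm]
    exact mul_le_mul_of_nonneg_left (hj i) (abs_nonneg _)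
  have h2 : |u j| - Real.log (2 * d) ≤ logKappa u := by
    rw [logKappa, Real.le_log_iff_exp_le (kappa_pos hd u), Real.exp_sub,
      Real.exp_log (by positivity)]
    have h3 : Real.cosh (u j) ≤ coshSum u :=
      Finset.single_le_sum (f := fun i => Real.cosh (u i)) (fun i _ => (Real.cosh_pos _).le)
        (Finset.mem_univ j)
    have h4 : Real.exp |u j| / 2 ≤ Real.cosh (u j) := by
      rw [← Real.cosh_abs, Real.cosh_eq]
      have := Real.exp_pos (-|u j|)
      linarith
    rw [kappa_eq]
    calc Real.exp |u j| / (2 * d) = 1 / d * (Real.exp |u j| / 2) := by field_simp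
      _ ≤ 1 / d * coshSum u := by gcongr; exact h4.trans h3
  have h5 : ‖u‖ / d ≤ |u j| := by
    rw [div_le_iff₀ hd0, EuclideanSpace.norm_eq]
    refine Real.sqrt_le_iff.2 ⟨by positivity, ?_⟩
    calc ∑ i, ‖u i‖ ^ 2 ≤ ∑ _i : Fin d, |u j| ^ 2 :=
          Finset.sum_le_sum fun i _ => pow_le_pow_left₀ (norm_nonneg _) (hj i) 2
      _ = d * |u j| ^ 2 := by simp
      _ ≤ (|u j| * d) ^ 2 := by
          have : (1 : ℝ) ≤ d := by exact_mod_cast hd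
          rw [mul_pow]
          nlinarith [mul_nonneg (sq_nonneg |u j|) (mul_nonneg hd0.le (sub_nonneg.2 this))]
  have h6 := mul_le_mul_of_nonneg_left h5 (sub_nonneg.2 hδ.le)
  unfold legendre
  linarith

theorem norm_le_of_legendre_nonneg {d : ℕ} (hd : 1 ≤ d) {δ : EuclideanSpace ℝ (Fin d)} {r : ℝ}
    (hr : r < 1) (hδ : norm1 δ ≤ r) {u : EuclideanSpace ℝ (Fin d)} (hu : 0 ≤ legendre δ u) :
    ‖u‖ ≤ d * Real.log (2 * d) / (1 - r) := by
  have hd0 : (0 : ℝ) < d := by exact_mod_cast hd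
  have h1 := legendre_le hd (hδ.trans_lt hr) u
  rw [le_div_iff₀ (by linarith)]
  have h2 : (1 - r) * (‖u‖ / d) ≤ (1 - norm1 δ) * (‖u‖ / d) :=
    mul_le_mul_of_nonneg_right (by linarith) (by positivity)
  have h3 : (1 - r) * (‖u‖ / d) ≤ Real.log (2 * d) := by linarith
  calc ‖u‖ * (1 - r) = d * ((1 - r) * (‖u‖ / d)) := by field_simp
    _ ≤ _ := mul_le_mul_of_nonneg_left h3 hd0.le

/-- The saddle point `s(δ)`, a point at which `⟨u, δ⟩ - log κ(u)` is maximal (arbitrary if there is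
none). -/
def saddle {d : ℕ} (δ : EuclideanSpace ℝ (Fin d)) : EuclideanSpace ℝ (Fin d) :=
  Classical.epsilon fun s => ∀ u, legendre δ u ≤ legendre δ s

theorem legendre_le_saddle {d : ℕ} (hd : 1 ≤ d) {δ : EuclideanSpace ℝ (Fin d)}
    (hδ : norm1 δ < 1) (u : EuclideanSpace ℝ (Fin d)) :
    legendre δ u ≤ legendre δ (saddle δ) := by
  refine Classical.epsilon_spec (p := fun s => ∀ u, legendre δ u ≤ legendre δ s) ?_ u
  refine (continuous_legendre hd δ).exists_forall_ge' 0 ?_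
  have hc := (isCompact_closedBall (0 : EuclideanSpace ℝ (Fin d))
    (d * Real.log (2 * d) / (1 - norm1 δ))).compl_mem_cocompact
  filter_upwards [hc] with v hv
  rw [legendre_zero hd]
  by_contra hlt
  exact hv (by simpa using norm_le_of_legendre_nonneg hd hδ le_rfl (not_le.1 hlt).le)

theorem phi_isGreatest {d : ℕ} (hd : 1 ≤ d) {δ : EuclideanSpace ℝ (Fin d)} (hδ : norm1 δ < 1) :
    IsGreatest (Set.range (legendre δ)) (phi δ) := by
  have h : IsGreatest (Set.range (legendre δ)) (legendre δ (saddle δ)) :=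
    ⟨⟨_, rfl⟩, by rintro _ ⟨u, rfl⟩; exact legendre_le_saddle hd hδ u⟩
  have : phi δ = legendre δ (saddle δ) := h.csSup_eq
  rwa [this]

theorem phi_eq {d : ℕ} (hd : 1 ≤ d) {δ : EuclideanSpace ℝ (Fin d)} (hδ : norm1 δ < 1) :
    phi δ = legendre δ (saddle δ) :=
  le_antisymm
    (by obtain ⟨u, hu⟩ := (phi_isGreatest hd hδ).1; rw [← hu]; exact legendre_le_saddle hd hδ u)
    ((phi_isGreatest hd hδ).2 ⟨_, rfl⟩)

/-- The saddle point equation `∇ log κ(s) = δ`. -/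
theorem sinh_saddle {d : ℕ} (hd : 1 ≤ d) {δ : EuclideanSpace ℝ (Fin d)} (hδ : norm1 δ < 1)
    (i : Fin d) : Real.sinh (saddle δ i) = δ i * coshSum (saddle δ) := by
  set s := saddle δ with hs
  set e : EuclideanSpace ℝ (Fin d) := EuclideanSpace.single i 1 with he
  have h1 : HasDerivAt (fun t : ℝ => legendre δ (s + t • e))
      (δ i - Real.sinh (s i) / coshSum s) 0 := by
    have h2 : HasDerivAt (fun t : ℝ => inner ℝ (s + t • e) δ) (δ i) 0 := by
      have : (fun t : ℝ => inner ℝ (s + t • e) δ) = fun t => inner ℝ s δ + t * δ i := by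
        funext t
        rw [inner_add_left, inner_smul_left, he, EuclideanSpace.inner_single_left]
        simp
      rw [this]
      simpa using ((hasDerivAt_id (0 : ℝ)).mul_const (δ i)).const_add (inner ℝ s δ)
    have h3 := h2.sub (hasDerivAt_logKappa hd s e)
    refine h3.congr_deriv ?_
    congr 2
    rw [Finset.sum_eq_single i]
    · simp [he]
    · intro j _ hj
      simp [he, hj]
    · simp
  have h4 : IsLocalMax (fun t : ℝ => legendre δ (s + t • e)) 0 :=
    Eventually.of_forall fun t => by
      simp only [zero_smul, add_zero]
      exact legendre_le_saddle hd hδ _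
  have h5 := h4.hasDerivAt_eq_zero h1
  have hS := coshSum_pos hd s
  rw [sub_eq_zero] at h5
  rw [h5]
  field_simp

theorem coshSum_le_of_sinh_eq {d : ℕ} (hd : 1 ≤ d) {δ s s' : EuclideanSpace ℝ (Fin d)}
    (hs : ∀ i, Real.sinh (s i) = δ i * coshSum s) (hs' : ∀ i, Real.sinh (s' i) = δ i * coshSum s') :
    coshSum s ≤ coshSum s' := by
  by_contra hlt
  rw [not_le] at hlt
  have hS := coshSum_pos hd s
  have hS' := coshSum_pos hd s'
  -- `cosh (s i) / S = √(1 / S² + δ i ²)` decreases in `S`, but sums to `1` for both points.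
  have key : ∀ i, Real.cosh (s i) / coshSum s < Real.cosh (s' i) / coshSum s' := by
    intro i
    refine lt_of_pow_lt_pow_left₀ 2 (div_pos (Real.cosh_pos _) hS').le ?_
    have h1 : ∀ u : EuclideanSpace ℝ (Fin d), Real.sinh (u i) = δ i * coshSum u →
        (Real.cosh (u i) / coshSum u) ^ 2 = (1 / coshSum u) ^ 2 + δ i ^ 2 := by
      intro u hu
      have := coshSum_pos hd u
      rw [div_pow, Real.cosh_sq, hu]
      field_simp
      ring
    rw [h1 s (hs i), h1 s' (hs' i)]
    have h2 : 1 / coshSum s < 1 / coshSum s' := one_div_lt_one_div_of_lt hS' hlt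
    have h3 := pow_lt_pow_left₀ h2 (by positivity) two_ne_zero
    linarith
  have h1 : ∀ u : EuclideanSpace ℝ (Fin d), ∑ i, Real.cosh (u i) / coshSum u = 1 := by
    intro u
    rw [← Finset.sum_div]
    exact div_self (coshSum_pos hd u).ne'
  have h2 := Finset.sum_lt_sum_of_nonempty (s := Finset.univ) ⟨⟨0, hd⟩, Finset.mem_univ _⟩
    fun i _ => key i
  rw [h1, h1] at h2
  exact lt_irrefl _ h2

theorem eq_of_sinh_eq {d : ℕ} (hd : 1 ≤ d) {δ s s' : EuclideanSpace ℝ (Fin d)}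
    (hs : ∀ i, Real.sinh (s i) = δ i * coshSum s) (hs' : ∀ i, Real.sinh (s' i) = δ i * coshSum s') :
    s = s' := by
  have h := le_antisymm (coshSum_le_of_sinh_eq hd hs hs') (coshSum_le_of_sinh_eq hd hs' hs)
  ext i
  exact Real.sinh_injective (by rw [hs, hs', h])

theorem tendsto_saddle {d : ℕ} (hd : 1 ≤ d) {δ : EuclideanSpace ℝ (Fin d)} (hδ : norm1 δ < 1) :
    Tendsto saddle (𝓝 δ) (𝓝 (saddle δ)) := by
  obtain ⟨r, hr, hr1⟩ := exists_between hδ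
  have hev : ∀ᶠ δ' in 𝓝 δ, norm1 δ' < r := continuous_norm1.continuousAt.eventually_lt
    continuousAt_const hr
  refine (isCompact_closedBall (0 : EuclideanSpace ℝ (Fin d))
    (d * Real.log (2 * d) / (1 - r))).tendsto_nhds_of_unique_mapClusterPt ?_ ?_
  · filter_upwards [hev] with δ' hδ'
    have := legendre_le_saddle hd (hδ'.trans hr1) 0
    rw [legendre_zero hd] at this
    simpa using norm_le_of_legendre_nonneg hd hr1 hδ'.le this
  · intro u _ hu
    obtain ⟨U, hU, hUu⟩ := mapClusterPt_iff_ultrafilter.1 hu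
    refine eq_of_sinh_eq hd (δ := δ) (fun i => ?_) (sinh_saddle hd hδ)
    have h1 : Tendsto (fun δ' => Real.sinh (saddle δ' i)) U (𝓝 (Real.sinh (u i))) :=
      ((Real.continuous_sinh.comp (by fun_prop :
        Continuous fun v : EuclideanSpace ℝ (Fin d) => v i)).tendsto u).comp hUu
    have h2 : Tendsto (fun δ' : EuclideanSpace ℝ (Fin d) => δ' i * coshSum (saddle δ')) U
        (𝓝 (δ i * coshSum u)) :=
      (((by fun_prop : Continuous fun v : EuclideanSpace ℝ (Fin d) => v i).tendsto δ).mono_left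
        hU).mul ((continuous_coshSum.tendsto u).comp hUu)
    refine tendsto_nhds_unique h1 (h2.congr' ?_)
    filter_upwards [hU hev] with δ' hδ'
    exact (sinh_saddle hd (hδ'.trans hr1) i).symm

/-- Envelope theorem: `0 ≤ φ(δ') - φ(δ) - ⟨s(δ), δ' - δ⟩ ≤ ⟨s(δ') - s(δ), δ' - δ⟩`, and the
saddle point is continuous. -/
theorem hasGradientAt_phi {d : ℕ} (hd : 1 ≤ d) {δ : EuclideanSpace ℝ (Fin d)} (hδ : norm1 δ < 1) :
    HasGradientAt phi (saddle δ) δ := by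
  rw [hasGradientAt_iff_isLittleO, Asymptotics.isLittleO_iff]
  intro c hc
  have hev : ∀ᶠ δ' in 𝓝 δ, norm1 δ' < 1 := continuous_norm1.continuousAt.eventually_lt
    continuousAt_const hδ
  filter_upwards [hev, Metric.tendsto_nhds.1 (tendsto_saddle hd hδ) c hc] with δ' h1 h2
  rw [dist_eq_norm] at h2
  have h3 := legendre_le_saddle hd h1 (saddle δ)
  have h4 := legendre_le_saddle hd hδ (saddle δ')
  rw [phi_eq hd h1, phi_eq hd hδ]
  have h5 : inner ℝ (saddle δ' - saddle δ) (δ' - δ) ≤ c * ‖δ' - δ‖ :=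
    (real_inner_le_norm _ _).trans (mul_le_mul_of_nonneg_right h2.le (norm_nonneg _))
  unfold legendre at *
  rw [inner_sub_left, inner_sub_right, inner_sub_right] at h5
  rw [inner_sub_right, Real.norm_eq_abs, abs_le]
  have h6 : 0 ≤ c * ‖δ' - δ‖ := by positivity
  constructor <;> linarith

theorem gradient_phi {d : ℕ} (hd : 1 ≤ d) {δ : EuclideanSpace ℝ (Fin d)} (hδ : norm1 δ < 1) :
    gradient phi δ = saddle δ := (hasGradientAt_phi hd hδ).gradient

/-! ### The tilted step distribution -/

/-- The weight `exp ⟨s, v⟩ / ∑ w, exp ⟨s, w⟩` of the step `v` under the exponential tilt by `s`. -/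
def tilt {d : ℕ} (s : EuclideanSpace ℝ (Fin d)) (v : Fin d × Bool) : ℝ :=
  Real.exp (∑ j, s j * stepVec v j) / (2 * coshSum s)

/-- The centred linear statistic `⟨θ, v - δ⟩` of the step `v`. -/
def centred {d : ℕ} (δ : EuclideanSpace ℝ (Fin d)) (θ : Fin d → ℝ) (v : Fin d × Bool) : ℝ :=
  ∑ j, θ j * stepVec v j - ∑ j, θ j * δ j

theorem sum_mul_stepVec {d : ℕ} (θ : Fin d → ℝ) (v : Fin d × Bool) :
    ∑ j, θ j * stepVec v j = if v.2 then θ v.1 else -θ v.1 := by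
  rcases v with ⟨i, b⟩
  rw [Finset.sum_eq_single i]
  · cases b <;> simp [stepVec]
  · intro j _ hj
    simp [stepVec, Pi.single_eq_of_ne hj]
  · simp

theorem tilt_nonneg {d : ℕ} (hd : 1 ≤ d) (s : EuclideanSpace ℝ (Fin d)) (v : Fin d × Bool) :
    0 ≤ tilt s v :=
  div_nonneg (Real.exp_pos _).le (by linarith [coshSum_pos hd s])

theorem tilt_true {d : ℕ} (s : EuclideanSpace ℝ (Fin d)) (i : Fin d) :
    tilt s (i, true) = Real.exp (s i) / (2 * coshSum s) := by
  rw [tilt, sum_mul_stepVec]; simp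

theorem tilt_false {d : ℕ} (s : EuclideanSpace ℝ (Fin d)) (i : Fin d) :
    tilt s (i, false) = Real.exp (-s i) / (2 * coshSum s) := by
  rw [tilt, sum_mul_stepVec]; simp

theorem sum_tilt {d : ℕ} (hd : 1 ≤ d) (s : EuclideanSpace ℝ (Fin d)) : ∑ v, tilt s v = 1 := by
  have hS := coshSum_pos hd s
  rw [Fintype.sum_prod_type]
  simp_rw [Fintype.sum_bool, tilt_true, tilt_false, ← add_div]
  rw [← Finset.sum_div, div_eq_one_iff_eq (by positivity), coshSum, Finset.mul_sum]
  refine Finset.sum_congr rfl fun i _ => ?_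
  rw [Real.cosh_eq]; ring

section saddlePoint

variable {d : ℕ} {δ s : EuclideanSpace ℝ (Fin d)}

theorem sum_tilt_mul_centred (hd : 1 ≤ d) (hs : ∀ i, Real.sinh (s i) = δ i * coshSum s)
    (θ : Fin d → ℝ) : ∑ v, tilt s v * centred δ θ v = 0 := by
  have hS := coshSum_pos hd s
  set m := ∑ j, θ j * δ j with hm
  have h1 : ∀ v, tilt s v * centred δ θ v
      = tilt s v * ∑ j, θ j * stepVec v j - m * tilt s v := fun v => by rw [centred]; ring
  simp_rw [h1]
  rw [Finset.sum_sub_distrib, ← Finset.mul_sum, sum_tilt hd, Fintype.sum_prod_type]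
  simp_rw [Fintype.sum_bool, tilt_true, tilt_false, sum_mul_stepVec]
  rw [hm, sub_eq_zero, mul_one]
  refine Finset.sum_congr rfl fun i _ => ?_
  have : δ i = Real.sinh (s i) / coshSum s := by rw [hs]; field_simp
  rw [this, Real.sinh_eq]
  simp
  field_simp
  ring

theorem matB_apply (hd : 1 ≤ d) (hs : ∀ i, Real.sinh (s i) = δ i * coshSum s) (i j : Fin d) :
    matB s i j = (if i = j then Real.cosh (s i) / coshSum s else 0) - δ i * δ j := by
  have hS := coshSum_pos hd s
  rw [matB, Matrix.of_apply, B_apply hd]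
  have h1 : ∀ k : Fin d, ∑ l, Real.sinh (s l) * (EuclideanSpace.single k (1 : ℝ)) l
      = Real.sinh (s k) := by
    intro k
    rw [Finset.sum_eq_single k]
    · simp
    · intro l _ hl; simp [hl]
    · simp
  rw [h1, h1, hs, hs, mul_div_cancel_right₀ _ hS.ne', mul_div_cancel_right₀ _ hS.ne']
  congr 1
  rw [Finset.sum_eq_single i]
  · by_cases h : i = j
    · subst h; simp
    · simp [h]
  · intro l _ hl; simp [hl]
  · simp

theorem dotProduct_matB (hd : 1 ≤ d) (hs : ∀ i, Real.sinh (s i) = δ i * coshSum s)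
    (θ : Fin d → ℝ) : dotProduct θ ((matB s).mulVec θ)
      = ∑ i, Real.cosh (s i) / coshSum s * θ i ^ 2 - (∑ i, θ i * δ i) ^ 2 := by
  have h : ∀ i, θ i * (matB s).mulVec θ i
      = Real.cosh (s i) / coshSum s * θ i ^ 2 - (θ i * δ i) * ∑ j, θ j * δ j := by
    intro i
    simp only [Matrix.mulVec, dotProduct, matB_apply hd hs, sub_mul, Finset.sum_sub_distrib,
      ite_mul, zero_mul, Finset.sum_ite_eq, Finset.mem_univ, if_true, Finset.mul_sum, mul_sub]
    congr 1
    · ring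
    · exact Finset.sum_congr rfl fun j _ => by ring
  simp only [dotProduct, h]
  rw [Finset.sum_sub_distrib, ← Finset.sum_mul, sq]

theorem sum_tilt_mul_centred_sq (hd : 1 ≤ d) (hs : ∀ i, Real.sinh (s i) = δ i * coshSum s)
    (θ : Fin d → ℝ) :
    ∑ v, tilt s v * centred δ θ v ^ 2 = dotProduct θ ((matB s).mulVec θ) := by
  have hS := coshSum_pos hd s
  rw [dotProduct_matB hd hs]
  set m := ∑ j, θ j * δ j with hm
  have h1 : ∀ v, tilt s v * centred δ θ v ^ 2
      = tilt s v * (∑ j, θ j * stepVec v j) ^ 2 - 2 * m * (tilt s v * centred δ θ v)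
        - m ^ 2 * tilt s v := fun v => by rw [centred]; ring
  simp_rw [h1]
  rw [Finset.sum_sub_distrib, Finset.sum_sub_distrib, ← Finset.mul_sum, ← Finset.mul_sum,
    sum_tilt hd, sum_tilt_mul_centred hd hs, Fintype.sum_prod_type]
  simp_rw [Fintype.sum_bool, tilt_true, tilt_false, sum_mul_stepVec]
  rw [mul_zero, sub_zero, mul_one]
  congr 1
  refine Finset.sum_congr rfl fun i _ => ?_
  rw [Real.cosh_eq]
  simp
  field_simp

theorem cosh_div_coshSum_ge (hd : 1 ≤ d) (hs : ∀ i, Real.sinh (s i) = δ i * coshSum s)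
    (i : Fin d) : (1 - norm1 δ) / d ≤ Real.cosh (s i) / coshSum s := by
  have hS := coshSum_pos hd s
  have hd0 : (0 : ℝ) < d := by exact_mod_cast hd
  have h1 : (1 - norm1 δ) * coshSum s ≤ d := by
    have e : (1 - norm1 δ) * coshSum s = ∑ i, (Real.cosh (s i) - |Real.sinh (s i)|) := by
      rw [Finset.sum_sub_distrib, sub_mul, one_mul, norm1, Finset.sum_mul, coshSum]
      congr 1
      refine Finset.sum_congr rfl fun j _ => ?_
      rw [hs, abs_mul, abs_of_pos hS, coshSum]
    rw [e]
    calc _ ≤ ∑ _i : Fin d, (1 : ℝ) := Finset.sum_le_sum fun j _ => by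
          rw [Real.abs_sinh, ← Real.cosh_abs, Real.cosh_sub_sinh]
          exact Real.exp_le_one_iff.2 (neg_nonpos.2 (abs_nonneg _))
      _ = d := by simp
  rw [div_le_div_iff₀ hd0 hS]
  nlinarith [Real.one_le_cosh (s i)]

theorem abs_le_cosh_div (hd : 1 ≤ d) (hs : ∀ i, Real.sinh (s i) = δ i * coshSum s) (i : Fin d) :
    |δ i| ≤ Real.cosh (s i) / coshSum s := by
  have hS := coshSum_pos hd s
  have h : |δ i| * coshSum s = Real.sinh |s i| := by
    rw [← Real.abs_sinh, hs, abs_mul, abs_of_pos hS]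
  rw [le_div_iff₀ hS, h, ← Real.cosh_abs]
  exact (Real.sinh_lt_cosh _).le

/-- Both `|δ i| ≤ c i` and `(1 - ‖δ‖₁) / d ≤ c i` for the diagonal part `c i = cosh (s i) / S` of
`B_s`; Cauchy–Schwarz with weights `|δ i|` bounds the rank one part. -/
theorem dotProduct_matB_ge (hd : 1 ≤ d) (hs : ∀ i, Real.sinh (s i) = δ i * coshSum s)
    (hδ : norm1 δ < 1) (θ : Fin d → ℝ) :
    (1 - norm1 δ) ^ 2 / d * ∑ i, θ i ^ 2 ≤ dotProduct θ ((matB s).mulVec θ) := by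
  rw [dotProduct_matB hd hs]
  have hcs : (∑ i, θ i * δ i) ^ 2 ≤ norm1 δ * ∑ i, |δ i| * θ i ^ 2 := by
    refine Finset.sum_sq_le_sum_mul_sum_of_sq_le_mul _ (fun i _ => abs_nonneg _)
      (fun i _ => by positivity) (fun i _ => le_of_eq ?_)
    rw [← mul_assoc, ← sq, sq_abs]; ring
  have h1 : ∑ i, |δ i| * θ i ^ 2 ≤ ∑ i, Real.cosh (s i) / coshSum s * θ i ^ 2 :=
    Finset.sum_le_sum fun i _ =>
      mul_le_mul_of_nonneg_right (abs_le_cosh_div hd hs i) (sq_nonneg _)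
  have h2 : (1 - norm1 δ) / d * ∑ i, θ i ^ 2 ≤ ∑ i, Real.cosh (s i) / coshSum s * θ i ^ 2 := by
    rw [Finset.mul_sum]
    exact Finset.sum_le_sum fun i _ =>
      mul_le_mul_of_nonneg_right (cosh_div_coshSum_ge hd hs i) (sq_nonneg _)
  have h3 : 0 ≤ norm1 δ := Finset.sum_nonneg fun i _ => abs_nonneg _
  have h4 := mul_le_mul_of_nonneg_left h1 h3
  have h5 := mul_le_mul_of_nonneg_left h2 (sub_nonneg.2 hδ.le)
  have h6 : (1 - norm1 δ) ^ 2 / d * ∑ i, θ i ^ 2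
      = (1 - norm1 δ) * ((1 - norm1 δ) / d * ∑ i, θ i ^ 2) := by ring
  rw [h6]
  linarith

theorem matB_posDef (hd : 1 ≤ d) (hs : ∀ i, Real.sinh (s i) = δ i * coshSum s)
    (hδ : norm1 δ < 1) : (matB s).PosDef := by
  have hd0 : (0 : ℝ) < d := by exact_mod_cast hd
  refine Matrix.PosDef.of_dotProduct_mulVec_pos ?_ fun θ hθ => ?_
  · ext i j
    rw [Matrix.conjTranspose_apply, star_trivial, matB_apply hd hs, matB_apply hd hs]
    by_cases h : i = j
    · subst h; rfl
    · rw [if_neg h, if_neg (Ne.symm h), mul_comm]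
  · rw [star_trivial]
    refine lt_of_lt_of_le ?_ (dotProduct_matB_ge hd hs hδ θ)
    have h1 : 0 < 1 - norm1 δ := sub_pos.2 hδ
    obtain ⟨i, hi⟩ := Function.ne_iff.1 hθ
    have h2 : 0 < ∑ i, θ i ^ 2 := Finset.sum_pos' (fun i _ => sq_nonneg _)
      ⟨i, Finset.mem_univ _, lt_of_le_of_ne (sq_nonneg _) (Ne.symm (pow_ne_zero 2 hi))⟩
    positivity

theorem abs_centred_le (hδ : norm1 δ ≤ 1) {θ : Fin d → ℝ} {r : ℝ} (hθ : ∀ i, |θ i| ≤ r)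
    (v : Fin d × Bool) : |centred δ θ v| ≤ 2 * r := by
  have hr : 0 ≤ r := (abs_nonneg _).trans (hθ v.1)
  have h1 : |∑ j, θ j * stepVec v j| ≤ r := by
    rw [sum_mul_stepVec]
    split_ifs
    · exact hθ _
    · rw [abs_neg]; exact hθ _
  have h2 : |∑ j, θ j * δ j| ≤ r := by
    refine (Finset.abs_sum_le_sum_abs _ _).trans ?_
    calc ∑ j, |θ j * δ j| ≤ ∑ j, r * |δ j| := Finset.sum_le_sum fun j _ => by
          rw [abs_mul]; exact mul_le_mul_of_nonneg_right (hθ j) (abs_nonneg _)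
      _ = r * norm1 δ := by rw [← Finset.mul_sum, norm1]
      _ ≤ r := mul_le_of_le_one_right hr hδ
  rw [centred]
  exact (abs_sub _ _).trans (by linarith)

theorem sq_le_mul_dotProduct_matB (hd : 1 ≤ d) (hs : ∀ i, Real.sinh (s i) = δ i * coshSum s)
    (hδ : norm1 δ < 1) (θ : Fin d → ℝ) (j : Fin d) :
    4 * θ j ^ 2 ≤ 4 * d / (1 - norm1 δ) ^ 2 * dotProduct θ ((matB s).mulVec θ) := by
  have hd0 : (0 : ℝ) < d := by exact_mod_cast hd
  have h1 : 0 < 1 - norm1 δ := sub_pos.2 hδ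
  have h2 := dotProduct_matB_ge hd hs hδ θ
  have h3 : θ j ^ 2 ≤ ∑ i, θ i ^ 2 :=
    Finset.single_le_sum (f := fun i => θ i ^ 2) (fun i _ => sq_nonneg _) (Finset.mem_univ j)
  have h4 := mul_le_mul_of_nonneg_left h2
    (by positivity : (0 : ℝ) ≤ 4 * d / (1 - norm1 δ) ^ 2)
  refine le_trans ?_ h4
  have h5 : 4 * d / (1 - norm1 δ) ^ 2 * ((1 - norm1 δ) ^ 2 / d * ∑ i, θ i ^ 2)
      = 4 * ∑ i, θ i ^ 2 := by field_simp
  rw [h5]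
  linarith

theorem centred_sq_le (hd : 1 ≤ d) (hs : ∀ i, Real.sinh (s i) = δ i * coshSum s)
    (hδ : norm1 δ < 1) (θ : Fin d → ℝ) (v : Fin d × Bool) :
    centred δ θ v ^ 2
      ≤ 4 * d / (1 - norm1 δ) ^ 2 * dotProduct θ ((matB s).mulVec θ) := by
  have : Nonempty (Fin d) := ⟨⟨0, hd⟩⟩
  obtain ⟨j, hj⟩ := Finite.exists_max fun i => |θ i|
  refine le_trans ?_ (sq_le_mul_dotProduct_matB hd hs hδ θ j)
  have h := pow_le_pow_left₀ (abs_nonneg _) (abs_centred_le hδ.le hj v) 2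
  rw [sq_abs, mul_pow, sq_abs] at h
  linarith

theorem exists_tilt_ge (hd : 1 ≤ d) (s : EuclideanSpace ℝ (Fin d)) :
    ∃ v, 1 / (2 * (d : ℝ)) ≤ tilt s v := by
  by_contra! h
  have hne : (Finset.univ : Finset (Fin d × Bool)).Nonempty := ⟨(⟨0, hd⟩, true), Finset.mem_univ _⟩
  have h1 := Finset.sum_lt_sum_of_nonempty hne fun v _ => h v
  rw [sum_tilt hd] at h1
  have hd0 : (d : ℝ) ≠ 0 := by have : 0 < d := hd; positivity
  simp at h1
  field_simp at h1
  exact lt_irrefl _ h1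

/-- For `θ` in the box attached to the axis of `v`, the angle `⟨θ, w - v⟩` between two steps stays
at distance at least `π/2` from the nonzero multiples of `2π`. -/
theorem abs_centred_sub_le (v : Fin d × Bool) {θ : Fin d → ℝ} (hθ : θ ∈ halfBox v.1)
    (w : Fin d × Bool) : |centred δ θ w - centred δ θ v| ≤ 3 * Real.pi / 2 := by
  have h0 : ∀ j, |θ j| ≤ halfWidth v.1 j := fun j => by
    have := hθ j (Set.mem_univ j)
    exact abs_le.2 ⟨this.1.le, this.2⟩
  have h1 : |∑ j, θ j * stepVec w j| ≤ Real.pi := by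
    have : |∑ j, θ j * stepVec w j| = |θ w.1| := by
      rw [sum_mul_stepVec]; split_ifs <;> simp
    rw [this]
    refine (h0 _).trans ?_
    unfold halfWidth
    split_ifs <;> linarith [Real.pi_pos]
  have h2 : |∑ j, θ j * stepVec v j| ≤ Real.pi / 2 := by
    have : |∑ j, θ j * stepVec v j| = |θ v.1| := by
      rw [sum_mul_stepVec]; split_ifs <;> simp
    rw [this]
    refine (h0 _).trans ?_
    simp [halfWidth]
  have h3 : centred δ θ w - centred δ θ v
      = ∑ j, θ j * stepVec w j - ∑ j, θ j * stepVec v j := by rw [centred, centred]; ring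
  rw [h3]
  exact (abs_sub _ _).trans (by linarith)

end saddlePoint

/-! ### The saddle point expansion -/

theorem laplace_tilt {d : ℕ} (hd : 1 ≤ d) (s : EuclideanSpace ℝ (Fin d)) (θ : Fin d → ℝ) :
    laplace (fun j => s j + θ j * Complex.I)
      = kappa s * charSum (tilt s) (fun v => ∑ j, θ j * stepVec v j) := by
  have hS : (coshSum s : ℂ) ≠ 0 := by exact_mod_cast (coshSum_pos hd s).ne'
  have hd0 : (d : ℂ) ≠ 0 := by have : 0 < d := hd; exact_mod_cast this.ne'
  rw [laplace, charSum, kappa_eq]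
  push_cast
  rw [mul_assoc, Finset.mul_sum, Finset.mul_sum, Finset.mul_sum]
  refine Finset.sum_congr rfl fun v _ => ?_
  have h1 : ∑ j, ((s j : ℂ) + θ j * Complex.I) * stepVec v j
      = ∑ j, (s j : ℂ) * stepVec v j + (∑ j, (θ j : ℂ) * stepVec v j) * Complex.I := by
    rw [Finset.sum_mul, ← Finset.sum_add_distrib]
    exact Finset.sum_congr rfl fun j _ => by ring
  rw [h1, Complex.exp_add, tilt]
  push_cast
  field_simp

theorem charSum_centred {d : ℕ} (δ s : EuclideanSpace ℝ (Fin d)) (θ : Fin d → ℝ) :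
    charSum (tilt s) (centred δ θ)
      = charSum (tilt s) (fun v => ∑ j, θ j * stepVec v j)
        * Complex.exp (-((∑ j, θ j * δ j : ℝ) * Complex.I)) := by
  rw [charSum, charSum, Finset.sum_mul]
  refine Finset.sum_congr rfl fun v _ => ?_
  rw [mul_assoc, ← Complex.exp_add, centred]
  push_cast
  congr 2
  ring

theorem laplace_pow_mul_exp {d : ℕ} (hd : 1 ≤ d) {δ : EuclideanSpace ℝ (Fin d)}
    (hδ : norm1 δ < 1) (n : ℕ) (x : Fin d → ℤ) (hx : ∀ j, (x j : ℝ) = n * δ j) (θ : Fin d → ℝ) :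
    laplace (fun j => saddle δ j + θ j * Complex.I) ^ n *
        Complex.exp (-∑ j, (saddle δ j + θ j * Complex.I) * x j)
      = (Real.exp (-(n * phi δ)) : ℂ) * charSum (tilt (saddle δ)) (centred δ θ) ^ n := by
  set s := saddle δ with hs
  have hphi : Real.exp (-(n * phi δ)) = kappa s ^ n * Real.exp (-(n * ∑ j, s j * δ j)) := by
    rw [phi_eq hd hδ, legendre, ← hs, inner_eq_sum, logKappa, mul_sub, neg_sub, sub_eq_add_neg,
      Real.exp_add, ← Real.log_pow, Real.exp_log (pow_pos (kappa_pos hd s) n)]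
  have hsum : ∑ j, ((s j : ℂ) + θ j * Complex.I) * x j
      = ((n * ∑ j, s j * δ j : ℝ) : ℂ) + n * ((∑ j, θ j * δ j : ℝ) * Complex.I) := by
    have h1 : ∀ j, ((s j : ℂ) + θ j * Complex.I) * x j
        = n * ((s j : ℂ) * δ j) + n * (((θ j : ℂ) * δ j) * Complex.I) := by
      intro j
      have : (x j : ℂ) = n * δ j := by exact_mod_cast congrArg (fun r : ℝ => (r : ℂ)) (hx j)
      rw [this]; ring
    simp_rw [h1]
    rw [Finset.sum_add_distrib, ← Finset.mul_sum, ← Finset.mul_sum, ← Finset.sum_mul]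
    push_cast
    ring
  rw [laplace_tilt hd, charSum_centred, hphi, hsum, mul_pow, mul_pow, ← Complex.exp_nat_mul,
    neg_add, Complex.exp_add]
  push_cast
  ring_nf

theorem transition_eq_integral_re {d : ℕ} (hd : 1 ≤ d) {δ : EuclideanSpace ℝ (Fin d)}
    (hδ : norm1 δ < 1) (j₀ : Fin d) (n : ℕ) (x : Fin d → ℤ) (hx : ∀ j, (x j : ℝ) = n * δ j)
    (hpar : ∑ i, x i ≡ (n : ℤ) [ZMOD 2]) :
    transition (step d) n x = 2 / (2 * Real.pi) ^ d * Real.exp (-(n * phi δ)) *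
      ∫ θ in halfBox j₀, (charSum (tilt (saddle δ)) (centred δ θ) ^ n).re := by
  have h := transition_eq_integral j₀ (fun j => saddle δ j) n x hpar
  simp_rw [laplace_pow_mul_exp hd hδ n x hx] at h
  rw [integral_const_mul, ← mul_assoc] at h
  have hint : IntegrableOn (fun θ => charSum (tilt (saddle δ)) (centred δ θ) ^ n)
      (halfBox j₀) := by
    refine integrableOn_halfBox j₀ ?_
    unfold charSum centred
    fun_prop
  have h2 : ∫ θ in halfBox j₀, (charSum (tilt (saddle δ)) (centred δ θ) ^ n).re
      = (∫ θ in halfBox j₀, charSum (tilt (saddle δ)) (centred δ θ) ^ n).re :=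
    integral_re hint
  rw [h2, ← Complex.re_ofReal_mul, ← Complex.ofReal_re (transition (step d) n x), h]
  push_cast
  rfl

/-- The comparison of integrands on all of `ℝ^d`. In the box this is the comparison of the
characteristic function with the Gaussian; outside it `K * b ≥ 1` and the Gaussian is itself of the
size of the error. -/
theorem abs_indicator_sub_exp_le {d : ℕ} (hd : 1 ≤ d) {δ s : EuclideanSpace ℝ (Fin d)}
    (hs : ∀ i, Real.sinh (s i) = δ i * coshSum s) (hδ : norm1 δ < 1) {v : Fin d × Bool}
    (hv : 1 / (2 * (d : ℝ)) ≤ tilt s v) {n : ℕ} (hn : 1 ≤ n) (θ : Fin d → ℝ) :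
    |(halfBox v.1).indicator (fun θ => (charSum (tilt s) (centred δ θ) ^ n).re) θ
        - Real.exp (-((n : ℝ) / 2 * dotProduct θ ((matB s).mulVec θ)))|
      ≤ 200000 * ((4 * d / (1 - norm1 δ) ^ 2) / n) * (200 * d) ^ 3 *
        Real.exp (-((n : ℝ) / (400 * d) * dotProduct θ ((matB s).mulVec θ))) := by
  have hd1 : (1 : ℝ) ≤ d := by exact_mod_cast hd
  have hd0 : (0 : ℝ) < d := by linarith
  have hn0 : (0 : ℝ) < n := by exact_mod_cast hn
  have hε : 0 < 1 - norm1 δ := sub_pos.2 hδ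
  have hε1 : 1 - norm1 δ ≤ 1 := by
    have : 0 ≤ norm1 δ := Finset.sum_nonneg fun i _ => abs_nonneg _
    linarith
  set b := dotProduct θ ((matB s).mulVec θ) with hb
  set K : ℝ := 4 * d / (1 - norm1 δ) ^ 2 with hK
  have hK1 : 1 ≤ K := by
    rw [hK, le_div_iff₀ (by positivity)]
    nlinarith
  have hb0 : 0 ≤ b := le_trans (by positivity) (dotProduct_matB_ge hd hs hδ θ)
  by_cases hθ : θ ∈ halfBox v.1
  · rw [Set.indicator_of_mem hθ]
    have hθπ : ∀ i, |θ i| ≤ Real.pi := fun i => by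
      have := hθ i (Set.mem_univ i)
      have hw : halfWidth v.1 i ≤ Real.pi := by
        unfold halfWidth; split_ifs <;> linarith [Real.pi_pos]
      exact abs_le.2 ⟨by linarith [this.1], this.2.trans hw⟩
    have h40 : ∀ w, centred δ θ w ^ 2 ≤ 40 := fun w => by
      have h := pow_le_pow_left₀ (abs_nonneg _) (abs_centred_le hδ.le hθπ w) 2
      rw [sq_abs] at h
      nlinarith [Real.pi_lt_d2, Real.pi_pos]
    have hf := norm_charSum_le (tilt_nonneg hd s) (sum_tilt hd s) (sum_tilt_mul_centred hd hs θ)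
      (sum_tilt_mul_centred_sq hd hs θ) v (abs_centred_sub_le v hθ)
    have hf' : ‖charSum (tilt s) (centred δ θ)‖ ≤ Real.exp (-((200 * (d : ℝ))⁻¹ * b)) := by
      refine hf.trans (Real.exp_le_exp.2 (neg_le_neg (mul_le_mul_of_nonneg_right ?_ hb0)))
      calc (200 * (d : ℝ))⁻¹ = 1 / (2 * d) / 100 := by field_simp; norm_num
        _ ≤ tilt s v / 100 := by gcongr
    have h := abs_re_charSum_pow_sub_exp_le (tilt_nonneg hd s) (sum_tilt hd s)
      (sum_tilt_mul_centred hd hs θ) (sum_tilt_mul_centred_sq hd hs θ) hK1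
      (centred_sq_le hd hs hδ θ) h40 (a := (200 * (d : ℝ))⁻¹) (by positivity)
      (by rw [one_div]; exact inv_anti₀ (by norm_num) (by linarith)) hf' hn
    rw [inv_inv] at h
    have e1 : (n : ℝ) / 2 * b = n * b / 2 := by ring
    have e2 : (n : ℝ) / (400 * d) * b = (200 * (d : ℝ))⁻¹ / 2 * (n * b) := by
      field_simp; ring
    rw [e1, e2]
    exact h
  · rw [Set.indicator_of_notMem hθ, zero_sub, abs_neg, abs_of_pos (Real.exp_pos _)]
    have hKb : 1 ≤ K * b := by
      simp only [halfBox, Set.mem_univ_pi, not_forall] at hθ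
      obtain ⟨j, hj⟩ := hθ
      refine le_trans ?_ (sq_le_mul_dotProduct_matB hd hs hδ θ j)
      have hw : 1 ≤ halfWidth v.1 j := by
        unfold halfWidth; split_ifs <;> linarith [Real.pi_gt_three]
      have h1 : 1 ≤ |θ j| := by
        by_contra! hlt
        rw [abs_lt] at hlt
        exact hj ⟨by linarith, by linarith⟩
      have h2 : 1 ≤ θ j ^ 2 := by rw [← sq_abs]; exact one_le_pow₀ h1
      linarith
    set t := (n : ℝ) * b with ht
    have ht0 : 0 ≤ t := by positivity
    have hKn : 1 ≤ K / n * t := by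
      rw [ht]
      calc (1 : ℝ) ≤ K * b := hKb
        _ = K / n * (n * b) := by field_simp
    have h1 : Real.exp (-((n : ℝ) / 2 * b)) ≤ K / n * (4 * Real.exp (-(1 / 4 * t))) := by
      have h2 := pow_mul_exp_neg_le (a := 1 / 2) (by norm_num) ht0 1
      norm_num at h2
      calc Real.exp (-((n : ℝ) / 2 * b)) = 1 * Real.exp (-(1 / 2 * t)) := by
            rw [one_mul, ht]; congr 1; ring
        _ ≤ K / n * t * Real.exp (-(1 / 2 * t)) :=
            mul_le_mul_of_nonneg_right hKn (Real.exp_pos _).le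
        _ = K / n * (t * Real.exp (-(1 / 2 * t))) := by ring
        _ ≤ K / n * (4 * Real.exp (-(1 / 4 * t))) := by
            refine mul_le_mul_of_nonneg_left ?_ (by positivity)
            norm_num
            exact h2
    have h3 : Real.exp (-(1 / 4 * t)) ≤ Real.exp (-((n : ℝ) / (400 * d) * b)) := by
      refine Real.exp_le_exp.2 (neg_le_neg ?_)
      calc (n : ℝ) / (400 * d) * b = 1 / (400 * d) * t := by rw [ht]; ring
        _ ≤ 1 / 4 * t := by
            refine mul_le_mul_of_nonneg_right ?_ ht0
            exact one_div_le_one_div_of_le (by norm_num) (by linarith)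
    have h4 : (1 : ℝ) ≤ (200 * d) ^ 3 := one_le_pow₀ (by linarith)
    calc _ ≤ K / n * (4 * Real.exp (-((n : ℝ) / (400 * d) * b))) := by
          refine h1.trans ?_
          gcongr
      _ = 4 * (K / n) * 1 * Real.exp (-((n : ℝ) / (400 * d) * b)) := by ring
      _ ≤ _ := by
          gcongr
          norm_num

theorem abs_integral_halfBox_sub_le {d : ℕ} (hd : 1 ≤ d) {δ s : EuclideanSpace ℝ (Fin d)}
    (hs : ∀ i, Real.sinh (s i) = δ i * coshSum s) (hδ : norm1 δ < 1) {v : Fin d × Bool}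
    (hv : 1 / (2 * (d : ℝ)) ≤ tilt s v) {n : ℕ} (hn : 1 ≤ n) :
    |(∫ θ in halfBox v.1, (charSum (tilt s) (centred δ θ) ^ n).re)
        - (2 * Real.pi / n) ^ ((d : ℝ) / 2) * (matB s).det ^ (-(1 / 2 : ℝ))|
      ≤ 200000 * ((4 * d / (1 - norm1 δ) ^ 2) / n) * (200 * d) ^ 3 * (200 * d) ^ ((d : ℝ) / 2) *
        ((2 * Real.pi / n) ^ ((d : ℝ) / 2) * (matB s).det ^ (-(1 / 2 : ℝ))) := by
  have hd0 : (0 : ℝ) < d := by exact_mod_cast hd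
  have hn0 : (0 : ℝ) < n := by exact_mod_cast hn
  have hpos := matB_posDef hd hs hδ
  obtain ⟨i1, e1⟩ := integral_exp_neg_posDef hpos (t := (n : ℝ) / 2) (by positivity)
  obtain ⟨i2, e2⟩ := integral_exp_neg_posDef hpos (t := (n : ℝ) / (400 * d)) (by positivity)
  have hmeas : MeasurableSet (halfBox v.1) := MeasurableSet.univ_pi fun _ => measurableSet_Ioc
  have i3 : Integrable ((halfBox v.1).indicator
      fun θ => (charSum (tilt s) (centred δ θ) ^ n).re) := by
    refine (integrable_indicator_iff hmeas).2 (integrableOn_halfBox _ ?_)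
    refine Complex.continuous_re.comp ?_
    unfold charSum centred
    fun_prop
  have h1 : Real.pi / ((n : ℝ) / 2) = 2 * Real.pi / n := by field_simp
  have h2 : Real.pi / ((n : ℝ) / (400 * d)) = 200 * d * (2 * Real.pi / n) := by
    field_simp; norm_num
  rw [h1] at e1
  rw [h2, Real.mul_rpow (by positivity) (by positivity)] at e2
  rw [← integral_indicator hmeas, ← e1, ← integral_sub i3 i1]
  refine abs_integral_le_integral_abs.trans ?_
  calc _ ≤ ∫ θ, _ := integral_mono (i3.sub i1).abs (i2.const_mul _)
          fun θ => abs_indicator_sub_exp_le hd hs hδ hv hn θ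
    _ = _ := by
      rw [integral_const_mul, e2, e1]
      ring

end SRW

end

theorem mainTheorem2 (d : ℕ) (hd : 1 ≤ d) :
    (∀ δ : EuclideanSpace ℝ (Fin d), SRW.norm1 δ < 1 →
      IsGreatest
        (Set.range fun x : EuclideanSpace ℝ (Fin d) => inner ℝ x δ - Real.log (SRW.kappa x))
        (SRW.phi δ) ∧
      DifferentiableAt ℝ SRW.phi δ ∧
      0 < (SRW.matB (gradient SRW.phi δ)).det) ∧
    (∃ C : ℝ, 0 < C ∧
      ∀ (n : ℕ) (x : Fin d → ℤ), 1 ≤ n →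
        SRW.latticeNorm1 x ≡ (n : ℤ) [ZMOD 2] →
        SRW.norm1 (SRW.drift n x) < 1 →
        ∃ E : ℝ,
          |E| ≤ C * ((n : ℝ)⁻¹ * ((1 - SRW.norm1 (SRW.drift n x)) ^ 2)⁻¹) ∧
          SRW.transition (SRW.step d) n x =
            (2 * Real.pi * (n : ℝ)) ^ (-((d : ℝ) / 2)) *
              (SRW.matB (gradient SRW.phi (SRW.drift n x))).det ^ (-(1 / 2 : ℝ)) *
              Real.exp (-((n : ℝ) * SRW.phi (SRW.drift n x))) *
              (2 + E)) ∧
    (∀ (n : ℕ) (x : Fin d → ℤ), 1 ≤ n →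
      ¬ SRW.latticeNorm1 x ≡ (n : ℤ) [ZMOD 2] →
      SRW.transition (SRW.step d) n x = 0) := by
  have hd0 : (0 : ℝ) < d := by exact_mod_cast hd
  refine ⟨fun δ hδ => ⟨SRW.phi_isGreatest hd hδ,
    (SRW.hasGradientAt_phi hd hδ).differentiableAt, ?_⟩, ?_, ?_⟩
  · rw [SRW.gradient_phi hd hδ]
    exact (SRW.matB_posDef hd (SRW.sinh_saddle hd hδ) hδ).det_pos
  · refine ⟨2 * (200000 * (4 * d) * (200 * d) ^ 3 * (200 * d) ^ ((d : ℝ) / 2)), by positivity,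
      fun n x hn hpar hδ => ?_⟩
    have hn0 : (0 : ℝ) < n := by exact_mod_cast hn
    set δ := SRW.drift n x with hδdef
    have hx : ∀ j, (x j : ℝ) = n * δ j := fun j => by
      simp only [hδdef, SRW.drift]
      field_simp
    obtain ⟨v, hv⟩ := SRW.exists_tilt_ge hd (SRW.saddle δ)
    have hI := SRW.abs_integral_halfBox_sub_le hd (SRW.sinh_saddle hd hδ) hδ hv hn
    have hp := SRW.transition_eq_integral_re hd hδ v.1 n x hx
      ((SRW.latticeNorm1_modEq x).symm.trans hpar)
    rw [SRW.gradient_phi hd hδ]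
    have hdet := (SRW.matB_posDef hd (SRW.sinh_saddle hd hδ) hδ).det_pos
    set J := ∫ θ in SRW.halfBox v.1,
      (SRW.charSum (SRW.tilt (SRW.saddle δ)) (SRW.centred δ θ) ^ n).re with hJ
    set D := (SRW.matB (SRW.saddle δ)).det ^ (-(1 / 2 : ℝ)) with hD
    set g := (2 * Real.pi / n) ^ ((d : ℝ) / 2) with hg
    have hD0 : 0 < D := Real.rpow_pos_of_pos hdet _
    have hg0 : 0 < g := Real.rpow_pos_of_pos (by positivity) _
    have hgD : (2 * Real.pi) ^ d * (2 * Real.pi * n) ^ (-((d : ℝ) / 2)) = g := by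
      rw [hg, Real.div_rpow (by positivity) hn0.le, Real.mul_rpow (by positivity) hn0.le,
        Real.rpow_neg hn0.le, ← mul_assoc, ← Real.rpow_natCast (2 * Real.pi) d,
        ← Real.rpow_add (by positivity), div_eq_mul_inv _ ((n : ℝ) ^ _)]
      congr 2
      ring
    refine ⟨2 * ((J - g * D) / (g * D)), ?_, ?_⟩
    · rw [abs_mul, abs_two, abs_div, abs_of_pos (mul_pos hg0 hD0), mul_assoc]
      refine mul_le_mul_of_nonneg_left ?_ zero_le_two
      rw [div_le_iff₀ (mul_pos hg0 hD0)]
      refine hI.trans (le_of_eq ?_)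
      rw [div_div, div_eq_mul_inv (4 * (d : ℝ)), mul_inv]
      ring
    · rw [hp]
      have hπ : (2 * Real.pi) ^ d ≠ 0 := by positivity
      have h1 : 2 + 2 * ((J - g * D) / (g * D)) = 2 * J / (g * D) := by
        field_simp
        ring
      rw [h1, ← hgD]
      have : (2 * Real.pi * (n : ℝ)) ^ (-((d : ℝ) / 2)) ≠ 0 :=
        (Real.rpow_pos_of_pos (by positivity) _).ne'
      field_simp
  · intro n x _ h
    exact SRW.transition_eq_zero n x fun h' => h ((SRW.latticeNorm1_modEq x).trans h')
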